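/- **Setting.** Let $G$ be a countable discrete group. Let $\mathcal T=(C_n,F_{n-1},\kappa_n,\nu_{n-1})_{n\ge1}$ consist of finite subsets $C_n$ ($n\ge 1$) and $F_n$ ($n\ge0$) of $G$, probability measures $\kappa_n$ on $G$ with support exactly $C_n$ and finite measures $\nu_n$ on $G$ with support exactly $F_n$, such that $F_0=\{1\}$, $\nu_0=\delta_1$ and, for all $n\ge 0$: $1\in F_n\cap C_{n+1}$, $\#C_{n+1}>1$, $F_nC_{n+1}\subset F_{n+1}$, $F_nc\cap F_nc'=\emptyset$ for distinct $c,c'\in C_{n+1}$, $\nu_{n+1}(fc)=\nu_n(f)\kappa_{n+1}(c)$ for $f\in F_n$, $c\in C_{n+1}$; moreover $\prod_{n\ge1}\max_{c\in C_n}\kappa_n(c)=0$ and, for all $g\in G$, $n\ge0$, $\lim_{m\to\infty}\nu_m\big((F_nC_{n+1}\cdots C_m)\cap g^{-1}F_m\big)=\nu_n(F_n)$. Let $X$ be the inductive limit of the compact spaces $X_n=F_n\times C_{n+1}\times C_{n+2}\times\cdots$ along the embeddings $(f_n,c_{n+1},c_{n+2},\dots)\mapsto(f_nc_{n+1},c_{n+2},\dots)$,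 with its Borel $\sigma$-algebra, and let $\mu$ be the Borel measure on $X$ with $\mu(\{x=(f_n,c_{n+1},\dots)\in X_n: f_n=f\})=\nu_n(f)$ for $f\in F_n$, $n\ge0$. The nonsingular $(C,F)$-action $T=(T_g)_{g\in G}$ associated with $\mathcal T$ is defined $\mu$-almost everywhere by $T_g(f_n,c_{n+1},\dots)=(gf_n,c_{n+1},\dots)$ whenever $(f_n,c_{n+1},\dots)\in X_n$ and $gf_n\in F_n$. For a strictly increasing sequence $\boldsymbol q=(q_n)_{n\ge0}$ of integers with $q_0=0$, the $\boldsymbol q$-telescoping $\widetilde{\mathcal T}=(\widetilde C_n,\widetilde F_{n-1},\widetilde\kappa_n,\widetilde\nu_{n-1})_{n\ge1}$ of $\mathcal T$ is given by $\widetilde F_n=F_{q_n}$, $\widetilde\nu_n=\nu_{q_n}$, $\widetilde C_{n+1}=C_{q_n+1}\cdots C_{q_{n+1}}$, $\widetilde\kappa_{n+1}=\kappa_{q_n+1}*\cdots*\kappa_{q_{n+1}}$. Let $\widetilde X$ be the corresponding space and $\iota_{\boldsymbol q}:X\to\widetilde X$ the canonical isomorphism, $\iota_{\boldsymbol q}(x)=(f_{q_n},c_{q_n+1}\cdots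 c_{q_{n+1}},c_{q_{n+1}+1}\cdots c_{q_{n+2}},\dots)\in\widetilde X_n$ for $x=(f_{q_n},c_{q_n+1},c_{q_n+2},\dots)\in X_{q_n}$. Let $\Gamma_1\supsetneq\Gamma_2\supsetneq\cdots$ be subgroups of finite index in $G$ with $\bigcap_{n\ge1}\bigcap_{g\in G}g\Gamma_ng^{-1}=\{1\}$, and let $Y=\projlim_n G/\Gamma_n$ be the associated topological $G$-odometer, i.e. the space of sequences $(g_n\Gamma_n)_{n\ge1}$ with $g_{n+1}\Gamma_n=g_n\Gamma_n$ for all $n$, on which $G$ acts by left translations. We say that $\widetilde{\mathcal T}$ is compatible with $y=(g_n\Gamma_n)_{n\ge1}\in Y$ if $\sum_{n\ge1}\widetilde\kappa_n(\{c\in\widetilde C_n: c\notin g_n\Gamma_ng_n^{-1}\})<\infty$. Let $\pi_{(\widetilde{\mathcal T},y)}$ be the partial mapping from $\widetilde X$ to $Y$ whose $l$-th coordinate is $\lim_{m\to\infty}f_nc_{n+1}\cdots c_m\,g_l\Gamma_l\in G/\Gamma_l$ at $(f_n,c_{n+1},\dots)\in\widetilde X_n$ (limits in the discrete topology; the mapping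 is defined where these limits exist for all $l$). A measurable mapping $\tau:X\to Y$ is called $G$-equivariant if for each $g\in G$, $\tau(T_gx)=g\tau(x)$ for $\mu$-a.e. $x$. It is one-to-one (mod 0) if it is injective on the complement of a $\mu$-null set. **Theorem.** (1) For each measurable $G$-equivariant mapping $\tau:X\to Y$ there are a strictly increasing sequence $\boldsymbol q$ of integers with $q_0=0$ and a point $y\in Y$ such that the $\boldsymbol q$-telescoping $\widetilde{\mathcal T}$ of $\mathcal T$ is compatible with $y$ and, for $\mu$-a.e. $x\in X$, $\pi_{(\widetilde{\mathcal T},y)}$ is defined at $\iota_{\boldsymbol q}(x)$ and $$\pi_{(\widetilde{\mathcal T},y)}(\iota_{\boldsymbol q}(x))=\tau(x).$$ (2) Suppose moreover that $\mu(X)<\infty$ (equivalently, $\lim_n\nu_n(F_n)<\infty$). Then for all $\tau$, $\boldsymbol q$, $y=(g_n\Gamma_n)_{n\ge1}$ as in (1), $\tau$ is one-to-one (mod 0) if and only if for each $n>0$ and $\epsilon>0$ there are $l>0$, a subset $D_l\subset G/\Gamma_l$ and $M>n$ such that for each $m>M$, $$\widetilde\nu_m\Big(\widetilde C_{n+1}\cdots\widetilde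 C_m\,\triangle\,\{f\in\widetilde F_m: fg_l\Gamma_l\in D_l\}\Big)<\epsilon.$$ (3) Conversely, if the $\boldsymbol q$-telescoping $\widetilde{\mathcal T}$ of $\mathcal T$ is compatible with $y\in Y$, then $\pi_{(\widetilde{\mathcal T},y)}\circ\iota_{\boldsymbol q}$ is defined $\mu$-a.e. and coincides $\mu$-a.e. with a measurable $G$-equivariant mapping $X\to Y$. -/

import Mathlib

open MeasureTheory Filter Topology
open scoped Pointwise ENNReal NNReal symmDiff

noncomputable section

/-- Coordinates with values in `Option α` are discrete. -/
instance optionMeasurableSpace {α : Type*} : MeasurableSpace (Option α) := ⊤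

/-- Convolution of two probabilities on a group. -/
def convPMF {G : Type*} [Group G] (p q : PMF G) : PMF G :=
  p.bind fun a => q.map fun b => a * b

/-- Raw data `(C_n, F_{n-1}, κ_n, ν_{n-1})_{n ≥ 1}`. Sequences which start at the index `1` are
shifted: `C n`, `κ n` are the `(n+1)`-st sets `C_{n+1}` and probabilities `κ_{n+1}`, while `F n`,
`ν n` are `F_n`, `ν_n`. The measure `ν n` is given by its weights. -/
structure CFData (G : Type*) where
  C : ℕ → Finset G
  F : ℕ → Finset G
  κ : ℕ → PMF G
  ν : ℕ → G → ℝ≥0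

namespace CFData

section Basic

variable {G : Type*} [Group G] [DecidableEq G] (T : CFData G)

/-- `ν_n(A)`, where `ν_n` is considered as a measure supported on `F_n`. -/
def nu (n : ℕ) (A : Set G) : ℝ≥0 := ∑ f ∈ T.F n, A.indicator (T.ν n) f

/-- The set `C_{n+1} C_{n+2} ⋯ C_m` (it is `{1}` if `m ≤ n`). -/
def Cprod (n m : ℕ) : Finset G := ((List.Ico n m).map T.C).prod

/-- The convolution `κ_{n+1} * κ_{n+2} * ⋯ * κ_m`. -/
def kprod (n m : ℕ) : PMF G := ((List.Ico n m).map T.κ).foldr convPMF (PMF.pure 1)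

/-- The parameters of a nonsingular `(C,F)`-action. -/
structure IsParam : Prop where
  F_zero : T.F 0 = {1}
  one_mem_F : ∀ n, 1 ∈ T.F n
  one_mem_C : ∀ n, 1 ∈ T.C n
  one_lt_card_C : ∀ n, 1 < (T.C n).card
  mul_subset : ∀ n, T.F n * T.C n ⊆ T.F (n + 1)
  disjoint : ∀ n, ∀ c ∈ T.C n, ∀ c' ∈ T.C n, c ≠ c' →
    Disjoint (T.F n * {c}) (T.F n * {c'})
  /-- `κ_{n+1}` is a non-degenerate probability on `C_{n+1}`. -/
  support_κ : ∀ n, (T.κ n).support = T.C n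
  /-- `ν_n` is a non-degenerate measure on `F_n`. -/
  support_ν : ∀ n, Function.support (T.ν n) = T.F n
  ν_zero : T.ν 0 1 = 1
  /-- `∏_n max_{c ∈ C_n} κ_n(c) = 0`. -/
  nonatomic : Tendsto (fun N => ∏ n ∈ Finset.range N, (T.C n).sup (T.κ n)) atTop (𝓝 0)
  ν_mul : ∀ n, ∀ f ∈ T.F n, ∀ c ∈ T.C n,
    (T.ν (n + 1) (f * c) : ℝ≥0∞) = T.ν n f * T.κ n c
  /-- `ν_m((F_n C_{n+1} ⋯ C_m) ∩ g⁻¹ F_m) → ν_n(F_n)`. -/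
  tendsto_ν : ∀ (g : G) (n : ℕ),
    Tendsto (fun m => T.nu m {h | h ∈ T.F n * T.Cprod n m ∧ g * h ∈ T.F m}) atTop
      (𝓝 (T.nu n (T.F n)))

/-- The space `X`, the inductive limit of the spaces `X_n = F_n × C_{n+1} × C_{n+2} × ⋯` with
respect to the embeddings `(f_n, c_{n+1}, c_{n+2}, …) ↦ (f_n c_{n+1}, c_{n+2}, …)`.
A point `x` is given by its first coordinates: `x n = some f_n` if
`x = (f_n, c_{n+1}, c_{n+2}, …) ∈ X_n`, and `x n = none` if `x ∉ X_n`. One has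
`f_{n+1} = f_n c_{n+1}`, so that these first coordinates determine `c_{n+1}, c_{n+2}, …`.
The last condition says that a point of `X_{n+1}` which is in the image of `X_n` belongs to
`X_n`. -/
def spaceSet : Set (ℕ → Option G) :=
  {x | (∀ n f, x n = some f → f ∈ T.F n) ∧
    (∀ n f, x n = some f → ∃ c ∈ T.C n, x (n + 1) = some (f * c)) ∧
    (∃ n f, x n = some f) ∧
    (∀ n, ∀ f ∈ T.F n, ∀ c ∈ T.C n, x (n + 1) = some (f * c) → x n = some f)}

/-- The space `X` as a type. Its `σ`-algebra is generated by the cylinders; it is the Borel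
`σ`-algebra of the (countably based) topology of `X`. -/
abbrev Space : Type _ := T.spaceSet

/-- The cylinder `[f]_n`. -/
def cyl (n : ℕ) (f : G) : Set T.Space := {x | x.1 n = some f}

/-- The elements `f ∈ F_n` such that `[f]_n` is not contained in `X_{n-1}`. -/
def newF : ℕ → Finset G
  | 0 => T.F 0
  | n + 1 => T.F (n + 1) \ (T.F n * T.C n)

/-- The first coordinates of the point `(f, c_{n+1}, c_{n+2}, …) ∈ X_n ∖ X_{n-1}`. -/
def path (n : ℕ) (p : G × (ℕ → G)) : ℕ → Option G := fun m =>
  if n ≤ m then some (p.1 * ((List.Ico n m).map p.2).prod) else none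

/-- The `(C,F)`-measure `μ` on `X`: the only measure on `X` with `μ([f]_n) = ν_n(f)` for all
`n ≥ 0` and `f ∈ F_n` (see `measure_cyl`). Its restriction to `X_n ∖ X_{n-1}` is the restriction
of the product measure `ν_n ⊗ κ_{n+1} ⊗ κ_{n+2} ⊗ ⋯` on `X_n`. -/
def measure [MeasurableSpace G] : Measure T.Space :=
  Measure.comap Subtype.val (Measure.sum fun n =>
    Measure.map (path n)
      ((∑ f ∈ T.newF n, T.ν n f • Measure.dirac f).prod
        (Measure.infinitePi fun k => (T.κ k).toMeasure)))

/-- `y = T_g x`: if `x = (f_n, c_{n+1}, …) ∈ X_n` and `g f_n ∈ F_n`, then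
`T_g x = (g f_n, c_{n+1}, …) ∈ X_n`. -/
def IsTranslate (g : G) (x y : T.Space) : Prop :=
  ∃ n, ∀ m, n ≤ m → ∃ f, x.1 m = some f ∧ y.1 m = some (g * f)

open Classical in
/-- The transformation `T_g`. It is naturally defined on the set `X^g` of those `x` for which
there is `n` with `x = (f_n, …) ∈ X_n` and `g f_n ∈ F_n`; this set is conull. We extend `T_g` by the
identity to the complement of `X^g`. -/
def act (g : G) (x : T.Space) : T.Space :=
  if h : ∃ y, T.IsTranslate g x y then h.choose else x

/-- The `l`-telescoping: `F̃_n = F_{l_n}`, `C̃_{n+1} = C_{l_n + 1} ⋯ C_{l_{n+1}}`,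
`ν̃_n = ν_{l_n}`, `κ̃_{n+1} = κ_{l_n + 1} * ⋯ * κ_{l_{n+1}}`. -/
def telescope (l : ℕ → ℕ) : CFData G where
  C n := T.Cprod (l n) (l (n + 1))
  F n := T.F (l n)
  κ n := T.kprod (l n) (l (n + 1))
  ν n := T.ν (l n)

variable {T}

theorem Cprod_succ {n m : ℕ} (h : n ≤ m) : T.Cprod n (m + 1) = T.Cprod n m * T.C m := by
  simp [Cprod, List.Ico.succ_top h]

theorem Cprod_self (n : ℕ) : T.Cprod n n = 1 := by simp [Cprod]

theorem IsParam.mul_Cprod_subset (hT : T.IsParam) {n m : ℕ} (h : n ≤ m) :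
    T.F n * T.Cprod n m ⊆ T.F m := by
  induction m, h using Nat.le_induction with
  | base => simp [Cprod_self]
  | succ m hm ih =>
    rw [Cprod_succ hm, ← mul_assoc]
    exact (Finset.mul_subset_mul_right ih).trans (hT.mul_subset m)

theorem exists_mem_Cprod (x : T.Space) {n m : ℕ} (h : n ≤ m) {f : G} (hf : x.1 n = some f) :
    ∃ c ∈ T.Cprod n m, x.1 m = some (f * c) := by
  induction m, h using Nat.le_induction with
  | base => exact ⟨1, by simp [Cprod_self], by simpa using hf⟩
  | succ m hm ih =>
    obtain ⟨c, hc, hx⟩ := ih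
    obtain ⟨d, hd, hx'⟩ := x.2.2.1 m _ hx
    exact ⟨c * d, by rw [Cprod_succ hm]; exact Finset.mul_mem_mul hc hd, by
      rw [hx', mul_assoc]⟩

theorem IsParam.eq_of_Cprod (hT : T.IsParam) (x : T.Space) {n m : ℕ} (h : n ≤ m) :
    ∀ f ∈ T.F n, ∀ c ∈ T.Cprod n m, x.1 m = some (f * c) → x.1 n = some f := by
  induction m, h using Nat.le_induction with
  | base =>
    intro f _ c hc hx
    have : c = 1 := by simpa [Cprod_self] using hc
    simpa [this] using hx
  | succ m hm ih =>
    intro f hf c hc hx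
    rw [Cprod_succ hm] at hc
    obtain ⟨a, ha, b, hb, rfl⟩ := Finset.mem_mul.1 hc
    refine ih f hf a ha (x.2.2.2.2 m (f * a) ?_ b hb (by rw [hx, mul_assoc]))
    exact hT.mul_Cprod_subset hm (Finset.mul_mem_mul hf ha)

/-- The canonical isomorphism `ι_l` of `X` onto the space of the `l`-telescoping:
`ι_l(x) = (f_{l_n}, c_{l_n + 1} ⋯ c_{l_{n+1}}, …)` if `x = (f_{l_n}, c_{l_n + 1}, …) ∈ X_{l_n}`. -/
def telescopeMap (hT : T.IsParam) {l : ℕ → ℕ} (hl : StrictMono l) (x : T.Space) :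
    (T.telescope l).Space :=
  ⟨fun n => x.1 (l n), by
    refine ⟨fun n f h => x.2.1 _ _ h,
      fun n f h => exists_mem_Cprod x (hl.monotone n.le_succ) h, ?_,
      fun n f hf c hc h => hT.eq_of_Cprod x (hl.monotone n.le_succ) f hf c hc h⟩
    obtain ⟨n, f, hf⟩ := x.2.2.2.1
    obtain ⟨c, -, hc⟩ := exists_mem_Cprod x (hl.le_apply (x := n)) hf
    exact ⟨n, _, hc⟩⟩

end Basic

section Measure

set_option linter.unusedSectionVars false

variable {G : Type*} [Group G] [DecidableEq G] [MeasurableSpace G] [Countable G]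
  [DiscreteMeasurableSpace G] {T : CFData G}

theorem measurable_path (n : ℕ) : Measurable (path n : G × (ℕ → G) → ℕ → Option G) := by
  refine measurable_pi_lambda _ fun m => ?_
  unfold path
  split_ifs
  · have h : Measurable fun p : G × (ℕ → G) => p.1 * ((List.Ico n m).map p.2).prod := by
      refine measurable_fst.mul ?_
      induction List.Ico n m with
      | nil => simp
      | cons a l ih =>
        simp only [List.map_cons, List.prod_cons]
        exact ((measurable_pi_apply a).comp measurable_snd).mul ih
    exact (Measurable.of_discrete (f := (some : G → Option G))).comp h
  · exact measurable_const

theorem measurable_coord (n : ℕ) (f : G) : Measurable fun x : ℕ → Option G => x n = some f :=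
  (measurable_from_top (f := fun a : Option G => a = some f)).comp (measurable_pi_apply n)

theorem measurableSet_spaceSet : MeasurableSet T.spaceSet := by
  refine measurableSet_setOfPred.2 (Measurable.and ?_ (Measurable.and ?_ (Measurable.and ?_ ?_)))
  · exact .forall fun n => .forall fun f => (measurable_coord n f).imp measurable_const
  · exact .forall fun n => .forall fun f => (measurable_coord n f).imp
      (.exists fun c => measurable_const.and (measurable_coord _ _))
  · exact .exists fun n => .exists fun f => measurable_coord n f
  · exact .forall fun n => .forall fun f => measurable_const.imp (.forall fun c =>
      measurable_const.imp ((measurable_coord _ _).imp (measurable_coord _ _)))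

theorem mul_cancel_of_disjoint (hT : T.IsParam) {n : ℕ} {f f' c c' : G} (hf : f ∈ T.F n)
    (hf' : f' ∈ T.F n) (hc : c ∈ T.C n) (hc' : c' ∈ T.C n) (h : f * c = f' * c') :
    f = f' ∧ c = c' := by
  by_cases hcc : c = c'
  · subst hcc
    exact ⟨mul_right_cancel h, rfl⟩
  · exact absurd h (Finset.disjoint_iff_ne.1 (hT.disjoint n c hc c' hc' hcc) _
      (Finset.mul_mem_mul hf (Finset.mem_singleton_self _)) _
      (Finset.mul_mem_mul hf' (Finset.mem_singleton_self _)))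

theorem newF_subset (n : ℕ) : T.newF n ⊆ T.F n := by
  cases n with
  | zero => exact subset_rfl
  | succ n => exact Finset.sdiff_subset

theorem path_succ {n m : ℕ} (h : n ≤ m) (p : G × (ℕ → G)) {f : G} (hf : path n p m = some f) :
    path n p (m + 1) = some (f * p.2 m) := by
  simp only [path, h, if_true, Option.some.injEq, h.trans m.le_succ] at hf ⊢
  rw [← hf, List.Ico.succ_top h]
  simp [mul_assoc]

theorem path_mem (hT : T.IsParam) {n : ℕ} {p : G × (ℕ → G)} (h1 : p.1 ∈ T.newF n)
    (h2 : ∀ k, p.2 k ∈ T.C k) : path n p ∈ T.spaceSet := by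
  have hlt : ∀ m f, path n p m = some f → n ≤ m := by
    intro m f h
    by_contra hn
    simp [path, hn] at h
  have hmem : ∀ m, n ≤ m → ∃ f ∈ T.F m, path n p m = some f := by
    intro m hm
    induction m, hm using Nat.le_induction with
    | base => exact ⟨p.1, newF_subset n h1, by simp [path]⟩
    | succ m hm ih =>
      obtain ⟨f, hf, hp⟩ := ih
      exact ⟨_, hT.mul_subset m (Finset.mul_mem_mul hf (h2 m)), path_succ hm p hp⟩
  refine ⟨?_, ?_, ?_, ?_⟩
  · intro m f h
    obtain ⟨f', hf', h'⟩ := hmem m (hlt m f h)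
    rw [h] at h'
    cases h'
    exact hf'
  · intro m f h
    exact ⟨_, h2 m, path_succ (hlt m f h) p h⟩
  · obtain ⟨f, -, h⟩ := hmem n le_rfl
    exact ⟨n, f, h⟩
  · intro m f hf c hc h
    rcases (hlt _ _ h).lt_or_eq with h' | h'
    · have h' : n ≤ m := by omega
      obtain ⟨f', hf', hp⟩ := hmem m h'
      have h3 := path_succ h' p hp
      rw [h] at h3
      have := mul_cancel_of_disjoint hT hf hf' hc (h2 m) (Option.some.inj h3)
      rw [hp, this.1]
    · subst h'
      have : p.1 = f * c := by simpa [path] using h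
      rw [this] at h1
      exact absurd (Finset.mul_mem_mul hf hc) (Finset.mem_sdiff.1 h1).2

/-- A point of `X` is determined by the coordinates `(f_n, c_{n+1}, c_{n+2}, …)` in `X_n`. -/
theorem space_ext {x y : T.Space} {n : ℕ} (h : ∀ m, n ≤ m → x.1 m = y.1 m) :
    x = y := by
  have hstep : ∀ (x y : T.Space) (k : ℕ), x.1 (k + 1) = y.1 (k + 1) →
      ∀ f, x.1 k = some f → y.1 k = some f := by
    intro x y k hk f hf
    obtain ⟨c, hc, h1⟩ := x.2.2.1 k f hf
    exact y.2.2.2.2 k f (x.2.1 k f hf) c hc (hk ▸ h1)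
  have key : ∀ k, x.1 (k + 1) = y.1 (k + 1) → x.1 k = y.1 k := fun k hk =>
    Option.ext fun f => ⟨hstep x y k hk f, hstep y x k hk.symm f⟩
  refine Subtype.ext (funext fun k => ?_)
  rcases le_total n k with hk | hk
  · exact h k hk
  · exact Nat.decreasingInduction (motive := fun k _ => x.1 k = y.1 k) (fun k _ ih => key k ih)
      (h n le_rfl) hk

/-- Every `(f, c_{n+1}, c_{n+2}, …) ∈ X_n` is a point of `X`. -/
theorem exists_point (hT : T.IsParam) (n : ℕ) : ∀ f ∈ T.F n, ∀ c : ℕ → G,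
    (∀ k, c k ∈ T.C k) →
    ∃ x : T.Space, ∀ m, n ≤ m → x.1 m = some (f * ((List.Ico n m).map c).prod) := by
  have hnew : ∀ n, ∀ f ∈ T.newF n, ∀ c : ℕ → G, (∀ k, c k ∈ T.C k) →
      ∃ x : T.Space, ∀ m, n ≤ m → x.1 m = some (f * ((List.Ico n m).map c).prod) :=
    fun n f hf c hc => ⟨⟨path n (f, c), path_mem hT hf hc⟩, fun m hm => by simp [path, hm]⟩
  induction n with
  | zero => exact hnew 0
  | succ n ih =>
    intro f hf c hc
    by_cases hfn : f ∈ T.F n * T.C n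
    · obtain ⟨a, ha, b, hb, rfl⟩ := Finset.mem_mul.1 hfn
      obtain ⟨x, hx⟩ := ih a ha (Function.update c n b) (fun k => by
        rcases eq_or_ne k n with rfl | hk
        · simpa using hb
        · simpa [hk] using hc k)
      refine ⟨x, fun m hm => ?_⟩
      rw [hx m (by omega), List.Ico.eq_cons (by omega), List.map_cons, List.prod_cons,
        Function.update_self, mul_assoc, List.map_congr_left (g := c)]
      intro k hk
      have := (List.Ico.mem.1 hk).1
      exact Function.update_of_ne (by omega) _ _
    · exact hnew (n + 1) f (Finset.mem_sdiff.2 ⟨hf, hfn⟩) c hc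

/-- `T_g x` is well defined on `X^g`. -/
theorem existsUnique_isTranslate (hT : T.IsParam) (g : G) (x : T.Space) {n : ℕ} {f : G}
    (hx : x.1 n = some f) (hg : g * f ∈ T.F n) : ∃! y, T.IsTranslate g x y := by
  have h1 : ∀ m, n ≤ m → ∃ h, x.1 m = some h := fun m hm => by
    obtain ⟨c, -, hc⟩ := exists_mem_Cprod x hm hx
    exact ⟨_, hc⟩
  have h2 : ∀ k, ∃ c ∈ T.C k, ∀ h, n ≤ k → x.1 k = some h → x.1 (k + 1) = some (h * c) := by
    intro k
    by_cases hk : n ≤ k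
    · obtain ⟨h, hh⟩ := h1 k hk
      obtain ⟨c, hc, h3⟩ := x.2.2.1 k h hh
      refine ⟨c, hc, fun h' _ hh' => ?_⟩
      rw [hh] at hh'
      cases hh'
      exact h3
    · exact ⟨1, hT.one_mem_C k, fun _ h => absurd h hk⟩
  choose c hc hxc using h2
  have h3 : ∀ m, n ≤ m → x.1 m = some (f * ((List.Ico n m).map c).prod) := by
    intro m hm
    induction m, hm using Nat.le_induction with
    | base => simpa using hx
    | succ m hm ih =>
      rw [hxc m _ hm ih, List.Ico.succ_top hm]
      simp [mul_assoc]
  obtain ⟨y, hy⟩ := exists_point hT n (g * f) hg c hc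
  refine ⟨y, ⟨n, fun m hm => ⟨_, h3 m hm, by rw [hy m hm, mul_assoc]⟩⟩, ?_⟩
  rintro z ⟨k, hk⟩
  refine space_ext (n := max n k) fun m hm => ?_
  obtain ⟨h, hh, hz⟩ := hk m (le_of_max_le_right hm)
  have hnm := le_of_max_le_left hm
  rw [h3 m hnm] at hh
  cases hh
  rw [hz, hy m hnm, mul_assoc]

/-- The law of the sequence `(c_1, c_2, …)`. -/
abbrev law (T : CFData G) : Measure (ℕ → G) := Measure.infinitePi fun k => (T.κ k).toMeasure

abbrev startMeasure (T : CFData G) (n : ℕ) : Measure G :=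
  ∑ f ∈ T.newF n, T.ν n f • Measure.dirac f

abbrev bigMeasure (T : CFData G) : Measure (ℕ → Option G) :=
  Measure.sum fun n => Measure.map (path n) ((T.startMeasure n).prod T.law)

instance (n : ℕ) : IsFiniteMeasure (T.startMeasure n) := by
  unfold startMeasure; infer_instance

theorem ae_start (n : ℕ) : ∀ᵐ f ∂T.startMeasure n, f ∈ T.newF n := by
  rw [ae_iff]
  simp only [startMeasure, Measure.coe_finsetSum, Finset.sum_apply, Measure.smul_apply]
  refine Finset.sum_eq_zero fun f hf => ?_
  simp [hf]

theorem ae_law (hT : T.IsParam) : ∀ᵐ c ∂T.law, ∀ k, c k ∈ T.C k := by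
  rw [ae_all_iff]
  intro k
  refine (measurePreserving_eval_infinitePi (fun k => (T.κ k).toMeasure) k).quasiMeasurePreserving.ae
    (p := fun c => c ∈ T.C k) ?_
  rw [ae_iff, PMF.toMeasure_apply_eq_zero_iff _ (MeasurableSet.of_discrete), hT.support_κ]
  exact Set.disjoint_left.2 fun a ha hb => hb ha

theorem ae_bigMeasure (hT : T.IsParam) : ∀ᵐ x ∂T.bigMeasure, x ∈ T.spaceSet := by
  rw [Measure.ae_sum_iff]
  intro n
  refine (ae_map_iff (p := (· ∈ T.spaceSet)) (measurable_path n).aemeasurable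
    measurableSet_spaceSet).2 ?_
  filter_upwards [Measure.quasiMeasurePreserving_fst.ae (ae_start (T := T) n),
    Measure.quasiMeasurePreserving_snd.ae (ae_law hT)] with p h1 h2
  exact path_mem hT h1 h2

theorem law_indep (h : G) (n m : ℕ) (f c : G) :
    T.law {ω | h * ((List.Ico n m).map ω).prod = f ∧ ω m = c} =
      T.law {ω | h * ((List.Ico n m).map ω).prod = f} * T.κ m c := by
  have hi : ProbabilityTheory.iIndepFun (fun (k : ℕ) (ω : ℕ → G) => ω k) T.law :=
    ProbabilityTheory.iIndepFun_infinitePi (P := fun k => (T.κ k).toMeasure)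
      (X := fun _ ω => ω) (fun _ => measurable_id)
  have h1 := ProbabilityTheory.indep_iSup_of_disjoint
    (fun k => (measurable_pi_apply k).comap_le) hi
    (S := {k | k < m}) (T := {m}) (by simp)
  have hA : MeasurableSet[⨆ k ∈ {k | k < m}, MeasurableSpace.comap (fun ω : ℕ → G => ω k) inferInstance]
      {ω | h * ((List.Ico n m).map ω).prod = f} := by
    have : Measurable[⨆ k ∈ {k | k < m}, MeasurableSpace.comap (fun ω : ℕ → G => ω k) inferInstance]
        (fun ω : ℕ → G => h * ((List.Ico n m).map ω).prod) := by
      refine Measurable.const_mul ?_ h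
      have hl : ∀ a ∈ List.Ico n m, a < m := fun a ha => (List.Ico.mem.1 ha).2
      revert hl
      induction List.Ico n m with
      | nil => intro _; simp
      | cons a l ih =>
        intro hl
        simp only [List.map_cons, List.prod_cons]
        refine Measurable.mul ?_ (ih fun b hb => hl b (List.mem_cons_of_mem _ hb))
        refine Measurable.mono (comap_measurable fun ω : ℕ → G => ω a) ?_ le_rfl
        exact le_iSup₂_of_le a (hl a List.mem_cons_self) le_rfl
    exact this (measurableSet_singleton f)
  have hB : MeasurableSet[⨆ k ∈ ({m} : Set ℕ), MeasurableSpace.comap (fun ω : ℕ → G => ω k) inferInstance]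
      {ω | ω m = c} := by
    exact le_iSup₂_of_le (f := fun k (_ : k ∈ ({m} : Set ℕ)) =>
      MeasurableSpace.comap (fun ω : ℕ → G => ω k) inferInstance) m (Set.mem_singleton m) le_rfl _
      ⟨{c}, measurableSet_singleton c, rfl⟩
  have h2 := (ProbabilityTheory.Indep_iff _ _ _).1 h1 _ _ hA hB
  have h3 : T.law {ω | ω m = c} = T.κ m c := by
    have := (measurePreserving_eval_infinitePi (fun k => (T.κ k).toMeasure) m).measure_preimage
      (measurableSet_singleton c).nullMeasurableSet
    rw [PMF.toMeasure_apply_singleton _ _ (measurableSet_singleton c)] at this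
    exact this
  rw [h3] at h2
  exact h2

theorem measurableSet_coord (n : ℕ) (f : G) : MeasurableSet {x : ℕ → Option G | x n = some f} :=
  measurableSet_setOfPred.2 (measurable_coord n f)

theorem bigMeasure_step (m : ℕ) (f c : G) :
    T.bigMeasure {x | x m = some f ∧ x (m + 1) = some (f * c)} =
      T.bigMeasure {x | x m = some f} * T.κ m c := by
  have hs := (measurableSet_coord m f).inter (measurableSet_coord (m + 1) (f * c))
  have hs' := measurableSet_coord m f
  change T.bigMeasure ({x | x m = some f} ∩ {x | x (m + 1) = some (f * c)}) = _
  rw [Measure.sum_apply _ hs, Measure.sum_apply _ hs', ← ENNReal.tsum_mul_right]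
  refine tsum_congr fun n => ?_
  rw [Measure.map_apply (measurable_path n) hs, Measure.map_apply (measurable_path n) hs']
  by_cases hn : n ≤ m
  · rw [Measure.prod_apply (measurable_path n hs), Measure.prod_apply (measurable_path n hs'),
      ← lintegral_mul_const' _ _ (PMF.apply_ne_top _ _)]
    refine lintegral_congr fun h => ?_
    convert law_indep h n m f c using 2
    · ext ω
      constructor
      · rintro ⟨h1, h2⟩
        have h1' : path n (h, ω) m = some f := h1
        have h2' : path n (h, ω) (m + 1) = some (f * c) := h2
        rw [path_succ hn _ h1'] at h2'
        exact ⟨by simpa [path, hn] using h1', by simpa using h2'⟩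
      · rintro ⟨h1, h2⟩
        have h1' : path n (h, ω) m = some f := by simpa [path, hn] using h1
        exact ⟨h1', by
          change path n (h, ω) (m + 1) = some (f * c)
          rw [path_succ hn _ h1']; simp [h2]⟩
    · congr 1
      ext ω
      simp [path, hn]
  · have : path n ⁻¹' {x : ℕ → Option G | x m = some f} = ∅ := by
      ext p; simp [path, hn]
    rw [Set.preimage_inter, this]; simp

theorem bigMeasure_coord (hT : T.IsParam) (m : ℕ) :
    ∀ f ∈ T.F m, T.bigMeasure {x | x m = some f} = T.ν m f := by
  have hnew : ∀ m, ∀ f ∈ T.newF m,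
      (T.startMeasure m).prod T.law (path m ⁻¹' {x | x m = some f}) = T.ν m f := by
    intro m f hf
    have : path m ⁻¹' {x : ℕ → Option G | x m = some f} = {f} ×ˢ Set.univ := by
      ext p; simp [path]
    rw [this, Measure.prod_prod, measure_univ, mul_one]
    simp only [startMeasure, Measure.coe_finsetSum, Finset.sum_apply, Measure.smul_apply]
    rw [Finset.sum_eq_single f]
    · simp
    · intro b _ hb; simp [hb]
    · exact fun h => absurd hf h
  have hone : ∀ m, ∀ f ∈ T.newF m, (∀ n, n ≠ m →
      (T.startMeasure n).prod T.law (path n ⁻¹' {x | x m = some f}) = 0) →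
      T.bigMeasure {x | x m = some f} = T.ν m f := by
    intro m f hf h
    rw [Measure.sum_apply _ (measurableSet_coord m f), tsum_eq_single m,
      Measure.map_apply (measurable_path m) (measurableSet_coord m f), hnew m f hf]
    intro n hn
    rw [Measure.map_apply (measurable_path n) (measurableSet_coord m f), h n hn]
  induction m with
  | zero =>
    intro f hf
    refine hone 0 f hf fun n hn => ?_
    have : path n ⁻¹' {x : ℕ → Option G | x 0 = some f} = ∅ := by
      ext p; simp [path, hn]
    simp [this]
  | succ m ih =>
    intro f hf
    by_cases hfm : f ∈ T.F m * T.C m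
    · obtain ⟨a, ha, c, hc, rfl⟩ := Finset.mem_mul.1 hfm
      rw [hT.ν_mul m a ha c hc, ← ih a ha, ← bigMeasure_step]
      refine measure_congr ?_
      filter_upwards [ae_bigMeasure hT] with x hx
      exact propext ⟨fun h => ⟨hx.2.2.2 m a ha c hc h, h⟩, fun h => h.2⟩
    · refine hone (m + 1) f (Finset.mem_sdiff.2 ⟨hf, hfm⟩) fun n hn => ?_
      rcases Nat.lt_or_gt_of_ne hn with h | h
      · refine measure_eq_zero_iff_ae_notMem.2 ?_
        filter_upwards [Measure.quasiMeasurePreserving_fst.ae (ae_start (T := T) n),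
          Measure.quasiMeasurePreserving_snd.ae (ae_law hT)] with p h1 h2 hp
        have hnm : n ≤ m := by omega
        have h3 := path_succ hnm p (f := p.1 * ((List.Ico n m).map p.2).prod) (by simp [path, hnm])
        have hp' : path n p (m + 1) = some f := hp
        rw [hp'] at h3
        rw [Option.some.inj h3] at hfm
        refine hfm (Finset.mul_mem_mul ((path_mem hT h1 h2).1 m _ ?_) (h2 m))
        simp [path, hnm]
      · have : path n ⁻¹' {x : ℕ → Option G | x (m + 1) = some f} = ∅ := by
          ext p; simp [path]; omega
        simp [this]

/-- The measure `μ` is determined by `μ([f]_n) = ν_n(f)`. -/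
theorem measure_cyl (hT : T.IsParam) (n : ℕ) (f : G) (hf : f ∈ T.F n) :
    T.measure (T.cyl n f) = T.ν n f := by
  rw [← bigMeasure_coord hT n f hf]
  change (Measure.comap Subtype.val T.bigMeasure) _ = _
  rw [(MeasurableEmbedding.subtype_coe measurableSet_spaceSet).comap_apply]
  refine measure_congr ?_
  filter_upwards [ae_bigMeasure hT] with x hx
  exact propext ⟨fun ⟨z, hz, h⟩ => h ▸ hz, fun h => ⟨⟨x, hx⟩, h, rfl⟩⟩

end Measure


end CFData

/-- The topological odometer `Y = projlim G/Γ_n`: sequences of cosets `(g_n Γ_n)_n` with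
`g_n Γ_n = g_{n+1} Γ_n`. The sequence `Γ_1, Γ_2, …` is shifted: `Γ n` is the `(n+1)`-st
subgroup. The space carries the product `σ`-algebra, i.e. its Borel `σ`-algebra. -/
abbrev Odometer {G : Type*} [Group G] (Γ : ℕ → Subgroup G) : Type _ :=
  {y : (n : ℕ) → G ⧸ Γ n // ∀ n, ∃ g : G, y (n + 1) = (g : G ⧸ Γ (n + 1)) ∧ y n = (g : G ⧸ Γ n)}

/-- The action `O` of `G` on `Y` by left translations. -/
instance odometerSMul {G : Type*} [Group G] (Γ : ℕ → Subgroup G) : SMul G (Odometer Γ) where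
  smul h y := ⟨fun n => h • y.1 n, fun n => by
    obtain ⟨g, h1, h2⟩ := y.2 n
    exact ⟨h * g, congrArg (h • ·) h1, congrArg (h • ·) h2⟩⟩

namespace CFData

section Factor

variable {G : Type*} [Group G] [DecidableEq G] (T : CFData G)

open Classical in
/-- The `(T, gΓ)`-factor mapping, a partial mapping from `X` to `G/Γ`:
`π(x) = lim_m f_n c_{n+1} ⋯ c_m gΓ = lim_m f_m gΓ` (in the discrete topology) for
`x = (f_n, c_{n+1}, …) ∈ X_n`, whenever this limit exists. -/
def cosetFactorMap {Γ : Subgroup G} (a : G ⧸ Γ) : T.Space →. G ⧸ Γ := fun x =>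
  ⟨∃ z : G ⧸ Γ, ∀ᶠ m in atTop, ∃ f, x.1 m = some f ∧ f • a = z, fun h => h.choose⟩

variable {Γ : ℕ → Subgroup G}

/-- The `(T, y)`-factor mapping, a partial mapping from `X` to `Y`: its `n`-th coordinate is the
`(T, g_n Γ_n)`-factor mapping, where `y = (g_n Γ_n)_n`. -/
def factorMap (y : Odometer Γ) : T.Space →. Odometer Γ := fun x =>
  ⟨∃ z : Odometer Γ, ∀ n, z.1 n ∈ T.cosetFactorMap (y.1 n) x, fun h => h.choose⟩

set_option linter.unusedSectionVars false in
theorem mem_cosetFactorMap {Γ : Subgroup G} (a z : G ⧸ Γ) (x : T.Space) :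
    z ∈ T.cosetFactorMap a x ↔ ∀ᶠ m in atTop, ∃ f, x.1 m = some f ∧ f • a = z := by
  refine ⟨fun ⟨h, hz⟩ => hz ▸ h.choose_spec, fun h => ⟨⟨z, h⟩, ?_⟩⟩
  have h' : ∃ z : G ⧸ Γ, ∀ᶠ m in atTop, ∃ f, x.1 m = some f ∧ f • a = z := ⟨z, h⟩
  obtain ⟨m, ⟨f, hf, h1⟩, f', hf', h2⟩ := (h'.choose_spec.and h).exists
  rw [hf] at hf'
  cases hf'
  exact h1.symm.trans h2

set_option linter.unusedSectionVars false in
theorem mem_factorMap (y z : Odometer Γ) (x : T.Space) :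
    z ∈ T.factorMap y x ↔ ∀ n, z.1 n ∈ T.cosetFactorMap (y.1 n) x := by
  refine ⟨fun ⟨h, hz⟩ => hz ▸ h.choose_spec, fun h => ⟨⟨z, h⟩, ?_⟩⟩
  have h' : ∃ z : Odometer Γ, ∀ n, z.1 n ∈ T.cosetFactorMap (y.1 n) x := ⟨z, h⟩
  exact Subtype.ext (funext fun n => Part.mem_unique (h'.choose_spec n) (h n))

/-- `T` is compatible with `y = (g_n Γ_n)_n`, i.e. `∑_n κ_n({c ∈ C_n | c ∉ g_n Γ_n g_n⁻¹}) < ∞`.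
The group `g_n Γ_n g_n⁻¹` is the stabilizer of the coset `g_n Γ_n`. -/
def Compatible (y : Odometer Γ) : Prop :=
  ∑' n, (T.κ n).toOuterMeasure {c | c ∈ T.C n ∧ c ∉ MulAction.stabilizer G (y.1 n)} < ∞

/-- For each `n > 0` and `ε > 0` there are `l`, a subset `D ⊆ G/Γ_l` and `M > n` such that
`ν_m(C_{n+1} ⋯ C_m ∆ {f ∈ F_m | f g_l Γ_l ∈ D}) < ε` for each `m > M`. -/
def ApproxCondition (y : Odometer Γ) : Prop :=
  ∀ n > 0, ∀ ε : ℝ≥0, 0 < ε → ∃ (l : ℕ) (D : Set (G ⧸ Γ l)), ∃ M > n, ∀ m > M,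
    T.nu m ((T.Cprod n m : Set G) ∆ {f | f ∈ T.F m ∧ f • y.1 l ∈ D}) < ε

/-- `τ` is a measurable `G`-equivariant (mod 0) mapping. -/
def IsEquivariant [MeasurableSpace G] (τ : T.Space → Odometer Γ) : Prop :=
  Measurable τ ∧ ∀ g : G, ∀ᵐ x ∂T.measure, τ (T.act g x) = g • τ x

/-- `τ` is one-to-one (mod 0). -/
def InjectiveModZero [MeasurableSpace G] (τ : T.Space → Odometer Γ) : Prop :=
  ∃ N : Set T.Space, T.measure N = 0 ∧ Set.InjOn τ Nᶜ

end Factor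

end CFData

end

noncomputable section

/-! The mapping `τ` is recovered from its behaviour on the cylinders `[1]_n`. A coordinate `τ_l`
takes values in the finite `G`-set `G/Γ_l`, so on `[1]_0` it is nearly a function of the coordinate
`f_n` when `n` is large; by averaging, it is nearly constant on some `[f₀]_n`. Between `[f₀]_n` and
`[f]_n` the action scales `μ` by a constant (`measure_cyl_inter_act_preimage`), so equivariance
carries this, with the same relative error, to all `[f]_n`: there `τ_l ≈ f a` with a single coset
`a` (`exists_concentration`). Compactness of the odometer provides one point `y` for all
coordinates, and telescoping makes the relative error at stage `n` at most `2^{-n}`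
(`exists_concentrated_telescoping`). If `[c]_{q_{n+1}} ⊆ [1]_{q_n}` contains a point at which
neither stage `n` nor stage `n+1` errs, then `c` fixes `y_n`; hence the increments that move `y_n`
have summable probability, which is compatibility (`compatible_of_concentration`). By
Borel–Cantelli, `τ(x)` is a.e. the limit of `f_{q_n} y`.

Conversely, compatibility and Borel–Cantelli imply that almost surely all late increments fix the
relevant cosets, so `f_{q_m} y_l` is eventually constant in `m`. The limit is equivariant because
`T_g` multiplies all late coordinates by `g` on the left.

For the injectivity criterion with finite `μ`, the quantities in the condition converge to
`μ([1]_{q_n} ∆ {τ_l ∈ D})` (`tendsto_nu_symmDiff`). Thus the condition says that each `[1]_{q_n}`,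
`n > 0`, is mod 0 a preimage under `τ`. If `τ` is one-to-one this follows from the Lusin–Souslin
theorem and approximation of Borel sets of the odometer by one-coordinate sets. In the other
direction, equivariance passes the property from `[1]_{q_n}` to all `[f]_{q_n}`, and these cylinders
separate points. -/

instance optionDiscreteMeasurableSpace {α : Type*} : DiscreteMeasurableSpace (Option α) :=
  ⟨fun _ => trivial⟩

/-- If the `σ`-algebra is generated by a sequence of discrete coordinates, each of which determines
the previous ones, then measurable sets are approximated by sets depending on one coordinate. -/
theorem exists_approx_of_coordinates {X : Type*} {m : MeasurableSpace X} {Z : ℕ → Type*}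
    [∀ n, MeasurableSpace (Z n)] [∀ n, DiscreteMeasurableSpace (Z n)] (φ : ∀ n, X → Z n)
    (hgen : m = ⨆ n, MeasurableSpace.comap (φ n) inferInstance)
    (hdet : ∀ k n, k ≤ n → ∀ x y, φ n x = φ n y → φ k x = φ k y)
    (μ : Measure X) [IsFiniteMeasure μ] {s : Set X} (hs : MeasurableSet s) {ε : ℝ≥0∞}
    (hε : ε ≠ 0) : ∃ N, ∀ n ≥ N, ∃ S : Set (Z n), μ (s ∆ (φ n ⁻¹' S)) < ε := by
  have hup : ∀ k n, k ≤ n → ∀ S : Set (Z k), ∃ S' : Set (Z n), φ k ⁻¹' S = φ n ⁻¹' S' := by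
    intro k n hkn S
    -- Since `φ n` determines `φ k`, the set `φ k ⁻¹' S` is a union of fibres of `φ n`, hence the
    -- preimage of its own image.
    refine ⟨φ n '' (φ k ⁻¹' S), Set.Subset.antisymm (Set.subset_preimage_image _ _) ?_⟩
    rintro x ⟨y, hy, hxy⟩
    have := hdet k n hkn _ _ hxy
    simpa [this] using hy
  have halg : IsSetAlgebra {t : Set X | ∃ n, ∃ S : Set (Z n), t = φ n ⁻¹' S} := by
    refine ⟨⟨0, ∅, by simp⟩, ?_, ?_⟩
    · rintro _ ⟨n, S, rfl⟩
      exact ⟨n, Sᶜ, by simp⟩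
    · rintro _ _ ⟨n, S, rfl⟩ ⟨k, S', rfl⟩
      obtain ⟨A, hA⟩ := hup n (max n k) (le_max_left _ _) S
      obtain ⟨B, hB⟩ := hup k (max n k) (le_max_right _ _) S'
      exact ⟨max n k, A ∪ B, by rw [hA, hB, Set.preimage_union]⟩
  have hgen' : m = MeasurableSpace.generateFrom {t : Set X | ∃ n, ∃ S : Set (Z n), t = φ n ⁻¹' S} := by
    apply le_antisymm
    · rw [hgen]
      refine iSup_le fun n => ?_
      rintro _ ⟨S, -, rfl⟩
      exact MeasurableSpace.measurableSet_generateFrom ⟨n, S, rfl⟩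
    · refine MeasurableSpace.generateFrom_le ?_
      rintro _ ⟨n, S, rfl⟩
      rw [hgen]
      exact (le_iSup (fun n => MeasurableSpace.comap (φ n) inferInstance) n) _
        ⟨S, MeasurableSet.of_discrete, rfl⟩
  obtain ⟨r, hr0, hr⟩ := ENNReal.lt_iff_exists_nnreal_btwn.1 (pos_iff_ne_zero.2 hε)
  obtain ⟨_, ⟨N, S, rfl⟩, h⟩ := (Measure.MeasureDense.of_generateFrom_isSetAlgebra_finite μ halg
    hgen').approx s hs (measure_ne_top _ _) r (by exact_mod_cast hr0)
  refine ⟨N, fun n hn => ?_⟩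
  obtain ⟨S', hS'⟩ := hup N n hn S
  refine ⟨S', ?_⟩
  rw [← hS']
  refine h.trans (lt_of_le_of_lt ?_ hr)
  simp

theorem convPMF_apply {G : Type*} [Group G] (p q : PMF G) (c : G) :
    convPMF p q c = ∑' a, p a * q (a⁻¹ * c) := by
  rw [convPMF, PMF.bind_apply]
  refine tsum_congr fun a => ?_
  congr 1
  rw [PMF.map_apply, tsum_eq_single (a⁻¹ * c)]
  · simp
  · intro b hb
    rw [if_neg]
    rintro rfl
    simp at hb

/-! ### Unique factorization in `F_n C_{n+1} ⋯ C_m`, convolutions, and the tree of cylinders -/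

namespace CFData

section Combinatorics

set_option linter.unusedSectionVars false

variable {G : Type*} [Group G] [DecidableEq G] {T : CFData G}

theorem Cprod_eq_cons {n m : ℕ} (h : n < m) : T.Cprod n m = T.C n * T.Cprod (n + 1) m := by
  simp [Cprod, List.Ico.eq_cons h]

theorem kprod_eq_cons {n m : ℕ} (h : n < m) :
    T.kprod n m = convPMF (T.κ n) (T.kprod (n + 1) m) := by
  simp [kprod, List.Ico.eq_cons h]

theorem kprod_self (n : ℕ) : T.kprod n n = PMF.pure 1 := by simp [kprod]

theorem Cprod_mul_Cprod {n k m : ℕ} (h : n ≤ k) (h' : k ≤ m) :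
    T.Cprod n k * T.Cprod k m = T.Cprod n m := by
  simp [Cprod, ← List.prod_append, ← List.map_append, List.Ico.append_consecutive h h']

theorem telescope_Cprod {q : ℕ → ℕ} (hq : StrictMono q) {n m : ℕ} (h : n ≤ m) :
    (T.telescope q).Cprod n m = T.Cprod (q n) (q m) := by
  induction m, h using Nat.le_induction with
  | base => simp [Cprod_self]
  | succ m hm ih =>
    rw [Cprod_succ hm, ih]
    exact Cprod_mul_Cprod (hq.monotone hm) (hq.monotone m.le_succ)

theorem telescope_nu (q : ℕ → ℕ) (n : ℕ) (A : Set G) : (T.telescope q).nu n A = T.nu (q n) A := rfl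

theorem IsParam.mul_mem (hT : T.IsParam) {n m : ℕ} (h : n ≤ m) {f c : G} (hf : f ∈ T.F n)
    (hc : c ∈ T.Cprod n m) : f * c ∈ T.F m :=
  hT.mul_Cprod_subset h (Finset.mul_mem_mul hf hc)

/-- Disjointness of the translates `F_m b`, `b ∈ C_{m+1}`, identifies the last factor; it is
cancelled and the induction continues with the shorter product. -/
theorem IsParam.mul_cancel (hT : T.IsParam) {n m : ℕ} (h : n ≤ m) : ∀ {f f' c c' : G},
    f ∈ T.F n → f' ∈ T.F n → c ∈ T.Cprod n m → c' ∈ T.Cprod n m → f * c = f' * c' →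
    f = f' ∧ c = c' := by
  induction m, h using Nat.le_induction with
  | base =>
    intro f f' c c' _ _ hc hc' h
    rw [Cprod_self, Finset.mem_one] at hc hc'
    subst hc hc'
    simpa using h
  | succ m hm ih =>
    intro f f' c c' hf hf' hc hc' h
    rw [Cprod_succ hm] at hc hc'
    obtain ⟨a, ha, b, hb, rfl⟩ := Finset.mem_mul.1 hc
    obtain ⟨a', ha', b', hb', rfl⟩ := Finset.mem_mul.1 hc'
    have hfa := hT.mul_mem hm hf ha
    have hfa' := hT.mul_mem hm hf' ha'
    rw [← mul_assoc, ← mul_assoc] at h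
    have hbb : b = b' := by
      by_contra hne
      exact Finset.disjoint_left.1 (hT.disjoint m b hb b' hb' hne)
        (Finset.mul_mem_mul hfa (Finset.mem_singleton_self b))
        (h ▸ Finset.mul_mem_mul hfa' (Finset.mem_singleton_self b'))
    subst hbb
    obtain ⟨rfl, rfl⟩ := ih hf hf' ha ha' (mul_right_cancel h)
    exact ⟨rfl, rfl⟩

theorem IsParam.C_subset_F (hT : T.IsParam) (n : ℕ) : T.C n ⊆ T.F (n + 1) := fun c hc =>
  hT.mul_subset n (by simpa using Finset.mul_mem_mul (hT.one_mem_F n) hc)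

theorem IsParam.kprod_support (hT : T.IsParam) {n m : ℕ} (h : n ≤ m) {c : G}
    (hc : c ∉ T.Cprod n m) : T.kprod n m c = 0 := by
  induction h using Nat.decreasingInduction generalizing c with
  | self =>
    rw [Cprod_self, Finset.mem_one] at hc
    simp [kprod_self, hc]
  | of_succ k hk ih =>
    rw [kprod_eq_cons hk, convPMF_apply, ENNReal.tsum_eq_zero]
    intro a
    rw [Cprod_eq_cons hk] at hc
    by_cases ha : a ∈ T.C k
    · rw [ih, mul_zero]
      intro hb
      exact hc (by simpa using Finset.mul_mem_mul ha hb)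
    · have : T.κ k a = 0 := by
        rw [PMF.apply_eq_zero_iff, hT.support_κ]
        exact ha
      rw [this, zero_mul]

/-- By unique factorization at most one term of the convolution sum survives. This needs `C_{n+1} ⊆
F_{n+1}`, so that the first factor can play the role of the element of `F`. -/
theorem IsParam.kprod_mul (hT : T.IsParam) {n m : ℕ} (h : n < m) {a b : G} (ha : a ∈ T.C n)
    (hb : b ∈ T.Cprod (n + 1) m) : T.kprod n m (a * b) = T.κ n a * T.kprod (n + 1) m b := by
  rw [kprod_eq_cons h, convPMF_apply, tsum_eq_single a]
  · simp
  · intro a' ha'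
    by_cases ha'' : a' ∈ T.C n
    · rw [hT.kprod_support h, mul_zero]
      intro hb'
      exact ha' (hT.mul_cancel h (hT.C_subset_F n ha'') (hT.C_subset_F n ha) hb' hb (by group)).1
    · have : T.κ n a' = 0 := by
        rw [PMF.apply_eq_zero_iff, hT.support_κ]
        exact ha''
      rw [this, zero_mul]

theorem IsParam.ν_mul_kprod (hT : T.IsParam) {n m : ℕ} (h : n ≤ m) {f c : G} (hf : f ∈ T.F n)
    (hc : c ∈ T.Cprod n m) : (T.ν m (f * c) : ℝ≥0∞) = T.ν n f * T.kprod n m c := by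
  induction h using Nat.decreasingInduction generalizing f c with
  | self =>
    rw [Cprod_self, Finset.mem_one] at hc
    simp [kprod_self, hc]
  | of_succ k hk ih =>
    rw [Cprod_eq_cons hk] at hc
    obtain ⟨a, ha, b, hb, rfl⟩ := Finset.mem_mul.1 hc
    rw [← mul_assoc, ih (hT.mul_subset k (Finset.mul_mem_mul hf ha)) hb, hT.ν_mul k f hf a ha,
      hT.kprod_mul hk ha hb, mul_assoc]

theorem IsParam.ν_ne_zero (hT : T.IsParam) {n : ℕ} {f : G} (hf : f ∈ T.F n) : T.ν n f ≠ 0 := by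
  have : f ∈ Function.support (T.ν n) := by rw [hT.support_ν]; exact hf
  exact this

/-- A coordinate of a point of `X` determines the previous ones. -/
theorem coord_eq_of_coord_eq {x y : T.Space} {n m : ℕ} (hnm : n ≤ m) (h : x.1 m = y.1 m) :
    x.1 n = y.1 n := by
  have hstep : ∀ (x y : T.Space) (k : ℕ), x.1 (k + 1) = y.1 (k + 1) →
      ∀ f, x.1 k = some f → y.1 k = some f := by
    intro x y k hk f hf
    obtain ⟨c, hc, h1⟩ := x.2.2.1 k f hf
    exact y.2.2.2.2 k f (x.2.1 k f hf) c hc (hk ▸ h1)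
  exact Nat.decreasingInduction (motive := fun k _ => x.1 k = y.1 k)
    (fun k _ hk => Option.ext fun f => ⟨hstep x y k hk f, hstep y x k hk.symm f⟩) h hnm

theorem cyl_eq_empty {n : ℕ} {f : G} (hf : f ∉ T.F n) : T.cyl n f = ∅ :=
  Set.eq_empty_of_forall_notMem fun x hx => hf (x.2.1 n f hx)

theorem cyl_mul_subset (hT : T.IsParam) {n m : ℕ} (h : n ≤ m) {f c : G} (hf : f ∈ T.F n)
    (hc : c ∈ T.Cprod n m) : T.cyl m (f * c) ⊆ T.cyl n f :=
  fun x hx => hT.eq_of_Cprod x h f hf c hc hx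

theorem cyl_eq_biUnion (hT : T.IsParam) {n m : ℕ} (h : n ≤ m) {f : G} (hf : f ∈ T.F n) :
    T.cyl n f = ⋃ c ∈ T.Cprod n m, T.cyl m (f * c) := by
  apply Set.Subset.antisymm
  · intro x hx
    obtain ⟨c, hc, h'⟩ := exists_mem_Cprod x h hx
    exact Set.mem_biUnion hc h'
  · exact Set.iUnion₂_subset fun c hc => cyl_mul_subset hT h hf hc

theorem cyl_disjoint {n : ℕ} {f f' : G} (h : f ≠ f') : Disjoint (T.cyl n f) (T.cyl n f') :=
  Set.disjoint_left.2 fun _ hx hx' => h (Option.some.inj (hx.symm.trans hx'))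

/-- Cylinders form a tree: a later coordinate determines all earlier ones. -/
theorem cyl_subset_or_disjoint {n m : ℕ} (hnm : n ≤ m) (f h : G) :
    T.cyl m f ⊆ T.cyl n h ∨ Disjoint (T.cyl m f) (T.cyl n h) := by
  rw [or_iff_not_imp_right, Set.not_disjoint_iff]
  rintro ⟨x, hx, hx'⟩ y hy
  exact (coord_eq_of_coord_eq hnm (hy.trans hx.symm)).trans hx'

/-- `T_g` in coordinates. -/
theorem act_coord (hT : T.IsParam) [MeasurableSpace G] [Countable G] [DiscreteMeasurableSpace G]
    {g : G} {x : T.Space} {n : ℕ} {f : G}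
    (hx : x.1 n = some f) (hg : g * f ∈ T.F n) {m : ℕ} (hm : n ≤ m) {h : G}
    (hh : x.1 m = some h) : (T.act g x).1 m = some (g * h) := by
  have hex : ∃ y, T.IsTranslate g x y := (existsUnique_isTranslate hT g x hx hg).exists
  obtain ⟨N, hN⟩ : T.IsTranslate g x (T.act g x) := by
    rw [act, dif_pos hex]
    exact hex.choose_spec
  -- The translate is controlled only beyond an unknown level `N`. The relation is read at level
  -- `max m N` and brought back to level `m`, where `g h` lies in `F_m` because `h` extends `f`.
  obtain ⟨c, hc, h'⟩ := exists_mem_Cprod x (le_max_left m N) hh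
  obtain ⟨_, h1, h2⟩ := hN (max m N) (le_max_right _ _)
  rw [h'] at h1
  cases h1
  obtain ⟨d, hd, h3⟩ := exists_mem_Cprod x hm hx
  rw [hh] at h3
  cases h3
  refine hT.eq_of_Cprod _ (le_max_left m N) _ ?_ c hc (by rw [h2]; group)
  rw [← mul_assoc]
  exact hT.mul_mem hm hg hd

end Combinatorics

end CFData

/-! ### Measure of cylinders, nonsingularity of the action, Borel–Cantelli -/

namespace CFData

section MeasureTheory

set_option linter.unusedSectionVars false

variable {G : Type*} [Group G] [DecidableEq G] [MeasurableSpace G] [Countable G]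
  [DiscreteMeasurableSpace G] {T : CFData G}

theorem measurable_space_coord (n : ℕ) : Measurable fun x : T.Space => x.1 n :=
  (measurable_pi_apply n).comp measurable_subtype_coe

theorem measurable_coord_mem (n : ℕ) (S : Set G) :
    Measurable fun x : T.Space => ∃ f, x.1 n = some f ∧ f ∈ S :=
  (Measurable.of_discrete (f := fun a : Option G => ∃ f, a = some f ∧ f ∈ S)).comp
    (measurable_space_coord n)

theorem measurableSet_cyl (n : ℕ) (f : G) : MeasurableSet (T.cyl n f) :=
  measurable_space_coord n (MeasurableSet.of_discrete (s := {some f}))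

theorem measurableSpace_eq_iSup : (inferInstance : MeasurableSpace T.Space) =
    ⨆ n, MeasurableSpace.comap (fun x : T.Space => x.1 n) inferInstance := by
  change MeasurableSpace.comap Subtype.val (⨆ n, MeasurableSpace.comap _ _) = _
  rw [MeasurableSpace.comap_iSup]
  simp only [MeasurableSpace.comap_comp]
  rfl

theorem isPiSystem_cyl : IsPiSystem {s | ∃ n f, s = T.cyl n f} := by
  rintro _ ⟨n, f, rfl⟩ _ ⟨m, h, rfl⟩ hne
  rw [← Set.not_disjoint_iff_nonempty_inter] at hne
  rcases le_total n m with hnm | hnm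
  · rcases cyl_subset_or_disjoint hnm h f with hs | hs
    · exact ⟨m, h, Set.inter_eq_right.2 hs⟩
    · exact absurd hs.symm hne
  · rcases cyl_subset_or_disjoint hnm f h with hs | hs
    · exact ⟨n, f, Set.inter_eq_left.2 hs⟩
    · exact absurd hs hne

theorem measurableSpace_eq_generateFrom : (inferInstance : MeasurableSpace T.Space) =
    MeasurableSpace.generateFrom {s | ∃ n f, s = T.cyl n f} := by
  apply le_antisymm
  · rw [measurableSpace_eq_iSup]
    refine iSup_le fun n => measurable_iff_comap_le.1 ?_
    let _ : MeasurableSpace T.Space := MeasurableSpace.generateFrom {s | ∃ n f, s = T.cyl n f}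
    have hc : ∀ f, MeasurableSet (T.cyl n f) := fun f =>
      MeasurableSpace.measurableSet_generateFrom ⟨n, f, rfl⟩
    refine measurable_to_countable' fun a => ?_
    cases a with
    | some f => exact hc f
    | none =>
      have : (fun x : T.Space => x.1 n) ⁻¹' {none} = (⋃ f, T.cyl n f)ᶜ := by
        ext x
        simp [cyl, Option.eq_none_iff_forall_ne_some]
      rw [this]
      exact (MeasurableSet.iUnion hc).compl
  · refine MeasurableSpace.generateFrom_le ?_
    rintro _ ⟨n, f, rfl⟩
    exact measurableSet_cyl n f

theorem iUnion_cyl : ⋃ p : ℕ × G, T.cyl p.1 p.2 = Set.univ :=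
  Set.eq_univ_of_forall fun x => by
    obtain ⟨n, f, h⟩ := x.2.2.2.1
    exact Set.mem_iUnion.2 ⟨(n, f), h⟩

/-- Two measures on `X` which coincide and are finite on cylinders are equal. -/
theorem measure_ext_of_cyl {μ μ' : Measure T.Space}
    (hfin : ∀ n f, μ (T.cyl n f) ≠ ∞) (h : ∀ n f, μ (T.cyl n f) = μ' (T.cyl n f)) : μ = μ' := by
  obtain ⟨e, he⟩ := exists_surjective_nat (ℕ × G)
  refine Measure.ext_of_generateFrom_of_iUnion {s | ∃ n f, s = T.cyl n f}
    (fun i => T.cyl (e i).1 (e i).2) measurableSpace_eq_generateFrom isPiSystem_cyl ?_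
    (fun i => ⟨_, _, rfl⟩) (fun i => hfin _ _) ?_
  · rw [← iUnion_cyl]
    exact he.iUnion_comp (fun p : ℕ × G => T.cyl p.1 p.2)
  · rintro _ ⟨n, f, rfl⟩
    exact h n f

/-- There are only countably many cylinders and they cover `X`. This keeps later arguments inside
sets of finite measure, since `μ` may be infinite. -/
theorem ae_of_ae_cyl (μ : Measure T.Space) {p : T.Space → Prop}
    (h : ∀ n, ∀ f ∈ T.F n, ∀ᵐ x ∂μ, x ∈ T.cyl n f → p x) : ∀ᵐ x ∂μ, p x := by
  have : ∀ᵐ x ∂μ, ∀ n f, f ∈ T.F n → x ∈ T.cyl n f → p x := by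
    rw [ae_all_iff]; intro n
    rw [ae_all_iff]; intro f
    by_cases hf : f ∈ T.F n
    · filter_upwards [h n f hf] with x hx _ using hx
    · exact .of_forall fun x h => absurd h hf
  filter_upwards [this] with x hx
  obtain ⟨n, f, hf⟩ := x.2.2.2.1
  exact hx n f (x.2.1 n f hf) hf

theorem measure_cyl_ne_top (hT : T.IsParam) (n : ℕ) (f : G) : T.measure (T.cyl n f) ≠ ∞ := by
  by_cases hf : f ∈ T.F n
  · rw [measure_cyl hT n f hf]; exact ENNReal.coe_ne_top
  · simp [cyl_eq_empty hf]

theorem measure_cyl_inter (hT : T.IsParam) {n m : ℕ} (h : n ≤ m) {f : G} (hf : f ∈ T.F n)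
    {A : Set T.Space} (hA : MeasurableSet A) (μ : Measure T.Space) :
    μ (T.cyl n f ∩ A) = ∑ c ∈ T.Cprod n m, μ (T.cyl m (f * c) ∩ A) := by
  rw [cyl_eq_biUnion hT h hf, Set.iUnion₂_inter, measure_biUnion_finset]
  · intro c _ c' _ hcc
    exact (cyl_disjoint fun h => hcc (mul_left_cancel h)).mono Set.inter_subset_left
      Set.inter_subset_left
  · exact fun c _ => (measurableSet_cyl _ _).inter hA

theorem sum_ν_mul (hT : T.IsParam) {n m : ℕ} (h : n ≤ m) {f : G} (hf : f ∈ T.F n) :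
    ∑ c ∈ T.Cprod n m, (T.ν m (f * c) : ℝ≥0∞) = T.ν n f := by
  have := measure_cyl_inter hT h hf MeasurableSet.univ T.measure
  simp only [Set.inter_univ] at this
  rw [measure_cyl hT n f hf] at this
  rw [this]
  exact Finset.sum_congr rfl fun c hc => (measure_cyl hT m _ (hT.mul_mem h hf hc)).symm

/-- `ν_n(A)` is the measure of the set of points `(f_n, c_{n+1}, …) ∈ X_n` with `f_n ∈ A`. -/
theorem measure_coord_mem (hT : T.IsParam) (n : ℕ) (A : Set G) :
    T.measure {x | ∃ f, x.1 n = some f ∧ f ∈ A} = T.nu n A := by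
  classical
  have : {x : T.Space | ∃ f, x.1 n = some f ∧ f ∈ A} =
      ⋃ f ∈ (T.F n).filter (· ∈ A), T.cyl n f := by
    ext x
    simp only [Set.mem_ofPred_eq, Set.mem_iUnion, Finset.mem_filter, cyl]
    constructor
    · rintro ⟨f, h, h'⟩
      exact ⟨f, ⟨x.2.1 n f h, h'⟩, h⟩
    · rintro ⟨f, ⟨-, h'⟩, h⟩
      exact ⟨f, h, h'⟩
  rw [this, measure_biUnion_finset (fun f _ f' _ h => cyl_disjoint h)
    (fun f _ => measurableSet_cyl n f), nu, ENNReal.ofNNReal_finsetSum, Finset.sum_filter]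
  refine Finset.sum_congr rfl fun f hf => ?_
  by_cases h : f ∈ A
  · simp [h, measure_cyl hT n f hf]
  · simp [h]

/-- The domain `X^g` of `T_g`. -/
def actDomain (T : CFData G) (g : G) : Set T.Space :=
  {x | ∃ n f, x.1 n = some f ∧ g * f ∈ T.F n}

theorem exists_isTranslate_iff (hT : T.IsParam) (g : G) (x : T.Space) :
    (∃ y, T.IsTranslate g x y) ↔ x ∈ T.actDomain g := by
  constructor
  · rintro ⟨y, n, h⟩
    obtain ⟨f, h1, h2⟩ := h n le_rfl
    exact ⟨n, f, h1, y.2.1 n _ h2⟩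
  · rintro ⟨n, f, h1, h2⟩
    exact (existsUnique_isTranslate hT g x h1 h2).exists

theorem isTranslate_act (hT : T.IsParam) {g : G} {x : T.Space} (hx : x ∈ T.actDomain g) :
    T.IsTranslate g x (T.act g x) := by
  have h := (exists_isTranslate_iff hT g x).2 hx
  rw [act, dif_pos h]
  exact h.choose_spec

theorem act_of_notMem (hT : T.IsParam) {g : G} {x : T.Space} (hx : x ∉ T.actDomain g) :
    T.act g x = x := by
  rw [act, dif_neg (mt (exists_isTranslate_iff hT g x).1 hx)]

theorem measurableSet_actDomain (g : G) : MeasurableSet (T.actDomain g) :=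
  measurableSet_setOfPred.2 <| .exists fun n =>
    measurable_coord_mem n {f | g * f ∈ T.F n}

/-- `T_g x ∈ [h]_m` in terms of the coordinates of `x`. -/
theorem act_mem_cyl_iff (hT : T.IsParam) {g : G} {x : T.Space} (hx : x ∈ T.actDomain g) {m : ℕ}
    {h : G} (hh : h ∈ T.F m) : T.act g x ∈ T.cyl m h ↔
      ∃ k ≥ m, ∃ n ≤ k, ∃ f, x.1 n = some f ∧ g * f ∈ T.F n ∧
        ∃ c ∈ T.Cprod m k, x.1 k = some (g⁻¹ * (h * c)) := by
  obtain ⟨n, f, h1, h2⟩ := hx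
  constructor
  · intro hy
    obtain ⟨c, hc, h3⟩ := exists_mem_Cprod _ (le_max_left m n) hy
    obtain ⟨d, hd, h4⟩ := exists_mem_Cprod _ (le_max_right m n) h1
    refine ⟨max m n, le_max_left _ _, n, le_max_right _ _, f, h1, h2, c, hc, ?_⟩
    rw [act_coord hT h1 h2 (le_max_right m n) h4] at h3
    rw [h4, ← Option.some.inj h3, inv_mul_cancel_left]
  · rintro ⟨k, hk, n, hn, f, h1, h2, c, hc, h3⟩
    have := act_coord hT h1 h2 hn h3
    rw [mul_inv_cancel_left] at this
    exact hT.eq_of_Cprod _ hk h hh c hc this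

theorem measurable_act (hT : T.IsParam) (g : G) : Measurable (T.act g) := by
  have h0 : ∀ m h, MeasurableSet (T.act g ⁻¹' T.cyl m h) := by
    intro m h
    by_cases hh : h ∈ T.F m
    · have : T.act g ⁻¹' T.cyl m h = (T.actDomain g ∩ {x | ∃ k ≥ m, ∃ n ≤ k, ∃ f, x.1 n = some f ∧
          g * f ∈ T.F n ∧ ∃ c ∈ T.Cprod m k, x.1 k = some (g⁻¹ * (h * c))}) ∪
          ((T.actDomain g)ᶜ ∩ T.cyl m h) := by
        ext x
        by_cases hx : x ∈ T.actDomain g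
        · simpa [hx] using act_mem_cyl_iff hT hx hh
        · simp [hx, act_of_notMem hT hx]
      rw [this]
      refine ((measurableSet_actDomain g).inter ?_).union
        ((measurableSet_actDomain g).compl.inter (measurableSet_cyl m h))
      refine measurableSet_setOfPred.2 <| .exists fun k => measurable_const.and <| .exists fun n =>
        measurable_const.and <| .exists fun f => Measurable.and ?_ <| measurable_const.and <|
        .exists fun c => measurable_const.and ?_
      · exact measurableSet_setOfPred.1 (measurableSet_cyl n f)
      · exact measurableSet_setOfPred.1 (measurableSet_cyl k _)
    · simp [cyl_eq_empty hh]
  have := measurable_generateFrom (f := T.act g) (s := {s | ∃ n f, s = T.cyl n f}) (by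
    rintro _ ⟨m, h, rfl⟩
    exact h0 m h)
  rwa [← measurableSpace_eq_generateFrom] at this

theorem act_mem_cyl (hT : T.IsParam) {n : ℕ} {f g : G} (hg : g * f ∈ T.F n) {x : T.Space}
    (hx : x ∈ T.cyl n f) : T.act g x ∈ T.cyl n (g * f) :=
  act_coord hT hx hg le_rfl hx

/-- The transformation `T_g` maps `[f]_n` onto `[gf]_n` and multiplies the measure by the constant
`ν_n(gf) / ν_n(f)`. -/
theorem measure_cyl_inter_act_preimage (hT : T.IsParam) {n : ℕ} {f g : G} (hf : f ∈ T.F n)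
    (hg : g * f ∈ T.F n) {A : Set T.Space} (hA : MeasurableSet A) :
    T.ν n f * T.measure (T.cyl n (g * f) ∩ A) =
      T.ν n (g * f) * T.measure (T.cyl n f ∩ T.act g ⁻¹' A) := by
  -- Both sides are measures in `A`, so it suffices to compare them on cylinders.
  suffices h : (T.ν n f : ℝ≥0∞) • T.measure.restrict (T.cyl n (g * f)) =
      (T.ν n (g * f) : ℝ≥0∞) • (T.measure.restrict (T.cyl n f)).map (T.act g) by
    have := congrArg (fun μ => μ A) h
    simp only [Measure.smul_apply, smul_eq_mul, Measure.map_apply (measurable_act hT g) hA,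
      Measure.restrict_apply hA, Measure.restrict_apply (measurable_act hT g hA)] at this
    rwa [Set.inter_comm, Set.inter_comm (T.cyl n f)]
  refine measure_ext_of_cyl ?_ ?_
  · intro m h
    simp only [Measure.smul_apply, smul_eq_mul]
    exact ENNReal.mul_ne_top ENNReal.coe_ne_top
      ((Measure.restrict_apply_le _ _).trans_lt (measure_cyl_ne_top hT m h).lt_top).ne
  · intro m h
    simp only [Measure.smul_apply, smul_eq_mul, Measure.map_apply (measurable_act hT g)
      (measurableSet_cyl m h), Measure.restrict_apply (measurableSet_cyl m h),
      Measure.restrict_apply (measurable_act hT g (measurableSet_cyl m h))]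
    -- A coarser cylinder contains `[gf]_n` or misses it. A finer one that meets `[gf]_n` is some
    -- `[gfc]_m`, with preimage `[fc]_m` in `[f]_n`; both sides then equal `ν_n(f) ν_n(gf)` times
    -- the convolution weight of `c`.
    rcases le_total m n with hmn | hmn
    · rcases cyl_subset_or_disjoint hmn (g * f) h with hs | hs
      · have hs' : T.cyl n f ⊆ T.act g ⁻¹' T.cyl m h := fun x hx => hs (act_mem_cyl hT hg hx)
        rw [Set.inter_eq_right.2 hs, Set.inter_eq_right.2 hs',
          measure_cyl hT n f hf, measure_cyl hT n _ hg, mul_comm]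
      · rw [Set.inter_comm, hs.inter_eq, Set.inter_comm, (Set.disjoint_left.2 fun x hx hx' =>
          Set.disjoint_left.1 hs (act_mem_cyl hT hg hx) hx' :
          Disjoint (T.cyl n f) (T.act g ⁻¹' T.cyl m h)).inter_eq]
        simp
    · by_cases hc : ∃ c ∈ T.Cprod n m, h = g * f * c
      · obtain ⟨c, hc, rfl⟩ := hc
        have h1 : T.act g ⁻¹' T.cyl m (g * f * c) ∩ T.cyl n f = T.cyl m (f * c) := by
          ext x
          constructor
          · rintro ⟨h1, h2⟩
            obtain ⟨d, hd, h3⟩ := exists_mem_Cprod x hmn h2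
            have h4 := act_coord hT h2 hg hmn h3
            rw [show (T.act g x).1 m = _ from h1] at h4
            have := Option.some.inj h4
            rw [mul_assoc] at this
            rw [cyl, Set.mem_ofPred_eq, h3, mul_left_cancel this]
          · intro hx
            have h2 := cyl_mul_subset hT hmn hf hc hx
            refine ⟨?_, h2⟩
            have := act_coord hT h2 hg hmn hx
            rwa [← mul_assoc] at this
        rw [h1, Set.inter_eq_left.2 (cyl_mul_subset hT hmn hg hc),
          measure_cyl hT m _ (hT.mul_mem hmn hf hc), measure_cyl hT m _ (hT.mul_mem hmn hg hc),
          hT.ν_mul_kprod hmn hf hc, hT.ν_mul_kprod hmn hg hc]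
        ring
      · push Not at hc
        have h1 : T.cyl m h ∩ T.cyl n (g * f) = ∅ := by
          refine Set.eq_empty_of_forall_notMem fun x hx => ?_
          obtain ⟨d, hd, h3⟩ := exists_mem_Cprod x hmn hx.2
          exact hc d hd (Option.some.inj (hx.1.symm.trans h3))
        have h2 : T.act g ⁻¹' T.cyl m h ∩ T.cyl n f = ∅ := by
          refine Set.eq_empty_of_forall_notMem fun x hx => ?_
          have : T.act g x ∈ T.cyl m h ∩ T.cyl n (g * f) := ⟨hx.1, act_mem_cyl hT hg hx.2⟩
          rwa [h1] at this
        simp [h1, h2]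

/-- `T_g` is defined almost everywhere. -/
theorem ae_mem_actDomain (hT : T.IsParam) (g : G) : ∀ᵐ x ∂T.measure, x ∈ T.actDomain g := by
  refine ae_of_ae_cyl _ fun n f hf => ?_
  have hX : T.measure {x | ∃ f, x.1 n = some f ∧ f ∈ (T.F n : Set G)} = T.nu n (T.F n) :=
    measure_coord_mem hT n _
  -- The sets in the limit condition on the parameters correspond to subsets of `X_n ∩ X^g`, so that
  -- intersection has the full measure of `X_n`.
  have h1 : T.measure ({x | ∃ f, x.1 n = some f ∧ f ∈ (T.F n : Set G)} ∩ T.actDomain g) ≥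
      T.nu n (T.F n) := by
    refine le_of_tendsto (ENNReal.tendsto_coe.2 (hT.tendsto_ν g n)) ?_
    filter_upwards [eventually_ge_atTop n] with m hm
    rw [← measure_coord_mem hT]
    refine measure_mono ?_
    rintro x ⟨h, hx, hh, hg⟩
    obtain ⟨a, ha, c, hc, rfl⟩ := Finset.mem_mul.1 hh
    exact ⟨⟨a, hT.eq_of_Cprod x hm a ha c hc hx, ha⟩, m, _, hx, hg⟩
  have h2 : T.measure ({x | ∃ f, x.1 n = some f ∧ f ∈ (T.F n : Set G)} \ T.actDomain g) = 0 := by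
    have h3 := measure_inter_add_sdiff (μ := T.measure)
      {x | ∃ f, x.1 n = some f ∧ f ∈ (T.F n : Set G)} (measurableSet_actDomain (T := T) g)
    rw [hX] at h3
    have h4 : (T.nu n (T.F n) : ℝ≥0∞) + T.measure
        ({x | ∃ f, x.1 n = some f ∧ f ∈ (T.F n : Set G)} \ T.actDomain g) ≤ T.nu n (T.F n) + 0 := by
      rw [add_zero]
      refine le_trans ?_ h3.le
      gcongr
    exact nonpos_iff_eq_zero.1 ((ENNReal.add_le_add_iff_left ENNReal.coe_ne_top).1 h4)
  filter_upwards [measure_eq_zero_iff_ae_notMem.1 h2] with x hx hxf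
  by_contra hd
  exact hx ⟨⟨f, hxf, hf⟩, hd⟩

/-- On each of the countably many pieces `[f]_n` with `g f ∈ F_n`, the measure is only scaled by a
positive constant, and these pieces exhaust the domain of `T_g`. -/
theorem quasiMeasurePreserving_act (hT : T.IsParam) (g : G) :
    Measure.QuasiMeasurePreserving (T.act g) T.measure T.measure := by
  refine ⟨measurable_act hT g, Measure.AbsolutelyContinuous.mk fun s hs h0 => ?_⟩
  rw [Measure.map_apply (measurable_act hT g) hs, measure_eq_zero_iff_ae_notMem]
  have h1 : ∀ᵐ x ∂T.measure, ∀ n f, f ∈ T.F n → g * f ∈ T.F n →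
      x ∉ T.cyl n f ∩ T.act g ⁻¹' s := by
    rw [ae_all_iff]; intro n
    rw [ae_all_iff]; intro f
    by_cases hf : f ∈ T.F n ∧ g * f ∈ T.F n
    · have h := measure_cyl_inter_act_preimage hT hf.1 hf.2 hs
      rw [measure_inter_null_of_null_right _ h0, mul_zero, eq_comm, mul_eq_zero] at h
      have h := h.resolve_left (by simpa using hT.ν_ne_zero hf.2)
      filter_upwards [measure_eq_zero_iff_ae_notMem.1 h] with x hx _ _ using hx
    · exact .of_forall fun x h h' => absurd ⟨h, h'⟩ hf
  filter_upwards [h1, ae_mem_actDomain hT g] with x hx hd hxs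
  obtain ⟨n, f, h2, h3⟩ := hd
  exact hx n f (x.2.1 n f h2) h3 ⟨h2, hxs⟩

/-- A Borel–Cantelli lemma in terms of relative measures of sets in cylinders. -/
theorem ae_eventually_notMem_of_cyl (hT : T.IsParam) {q : ℕ → ℕ} (hq : StrictMono q)
    {A : ℕ → Set T.Space} (hA : ∀ n, MeasurableSet (A n)) {e : ℕ → ℝ≥0∞} (he : ∑' n, e n ≠ ∞)
    (h : ∀ n, ∀ f ∈ T.F (q n), T.measure (T.cyl (q n) f ∩ A n) ≤ e n * T.ν (q n) f) :
    ∀ᵐ x ∂T.measure, ∀ᶠ n in atTop, x ∉ A n := by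
  refine ae_of_ae_cyl _ fun k f hf => ?_
  have h1 : ∀ n, T.measure (T.cyl k f ∩ A (n + k)) ≤ e (n + k) * T.ν k f := by
    intro n
    -- The shift by `k` makes level `q (n + k)` refine level `k`, so the relative bounds on the
    -- small cylinders add up to one on `[f]_k`.
    have hk : k ≤ q (n + k) := (Nat.le_add_left k n).trans hq.le_apply
    rw [measure_cyl_inter hT hk hf (hA _), ← sum_ν_mul hT hk hf, Finset.mul_sum]
    exact Finset.sum_le_sum fun c hc => h _ _ (hT.mul_mem hk hf hc)
  have h2 : ∑' n, T.measure (T.cyl k f ∩ A (n + k)) ≠ ∞ := by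
    refine ne_top_of_le_ne_top ?_ (ENNReal.tsum_le_tsum h1)
    rw [ENNReal.tsum_mul_right]
    refine ENNReal.mul_ne_top (ne_top_of_le_ne_top he ?_) ENNReal.coe_ne_top
    exact ENNReal.tsum_comp_le_tsum_of_injective (add_left_injective k) e
  filter_upwards [ae_eventually_notMem h2] with x hx hxf
  rw [← map_add_atTop_eq_nat k, eventually_map]
  filter_upwards [hx] with n hn hn'
  exact hn ⟨hxf, hn'⟩

end MeasureTheory
end CFData

/-! ### Coordinates of the odometer -/

section Odometer

variable {G : Type*} [Group G] {Γ : ℕ → Subgroup G}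

theorem odometer_coord (hΓ : Antitone Γ) (y : Odometer Γ) {k n : ℕ} (h : k ≤ n) {g : G}
    (hg : y.1 n = (g : G ⧸ Γ n)) : y.1 k = (g : G ⧸ Γ k) := by
  refine Nat.decreasingInduction (motive := fun k _ => y.1 k = (g : G ⧸ Γ k)) ?_ hg h
  intro k _ ih
  obtain ⟨a, h1, h2⟩ := y.2 k
  rw [h1, QuotientGroup.eq] at ih
  rw [h2, QuotientGroup.eq]
  exact hΓ k.le_succ ih

/-- A coordinate determines the earlier ones equivariantly. Every passage from stage `n` to a fixed
coordinate `k ≤ n` rests on this. -/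
theorem odometer_smul_coord (hΓ : Antitone Γ) (y z : Odometer Γ) {k n : ℕ} (h : k ≤ n) {f : G}
    (hf : f • y.1 n = z.1 n) : f • y.1 k = z.1 k := by
  obtain ⟨g, hg⟩ := QuotientGroup.mk_surjective (y.1 n)
  have h1 := odometer_coord hΓ y h hg.symm
  have h2 : z.1 n = ((f * g : G) : G ⧸ Γ n) := by rw [← hf, ← hg]; rfl
  rw [h1, odometer_coord hΓ z h h2]
  rfl

theorem odometer_coord_eq (hΓ : Antitone Γ) (y z : Odometer Γ) {k n : ℕ} (h : k ≤ n)
    (hf : y.1 n = z.1 n) : y.1 k = z.1 k := by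
  simpa using odometer_smul_coord hΓ y z h (f := 1) (by simpa using hf)

/-- The image of `g ∈ G` in the odometer. -/
def odometerOf (Γ : ℕ → Subgroup G) (g : G) : Odometer Γ :=
  ⟨fun n => (g : G ⧸ Γ n), fun _ => ⟨g, rfl, rfl⟩⟩

end Odometer

/-! ### From compatible telescopings to equivariant mappings -/

namespace CFData

section Limits

set_option linter.unusedSectionVars false

variable {G : Type*} [Group G] [DecidableEq G] [MeasurableSpace G] [Countable G]
  [DiscreteMeasurableSpace G] {T : CFData G} {Γ : ℕ → Subgroup G}

theorem mem_factorMap_telescope (hT : T.IsParam) {q : ℕ → ℕ} (hq : StrictMono q)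
    (y z : Odometer Γ) (x : T.Space) :
    z ∈ (T.telescope q).factorMap y (telescopeMap hT hq x) ↔
      ∀ l, ∀ᶠ m in atTop, ∃ f, x.1 (q m) = some f ∧ f • y.1 l = z.1 l := by
  rw [mem_factorMap]
  refine forall_congr' fun l => ?_
  rw [mem_cosetFactorMap]
  rfl

/-- The measure of the points of a cylinder whose next coordinate lies in a given set. -/
theorem measure_cyl_inter_step (hT : T.IsParam) {n m : ℕ} (h : n ≤ m) {f : G} (hf : f ∈ T.F n)
    (S : Set G) :
    T.measure (T.cyl n f ∩ {x | ∃ a c, x.1 n = some a ∧ c ∈ S ∧ x.1 m = some (a * c)}) ≤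
      (T.kprod n m).toOuterMeasure {c | c ∈ T.Cprod n m ∧ c ∈ S} * T.ν n f := by
  classical
  have h1 : T.cyl n f ∩ {x | ∃ a c, x.1 n = some a ∧ c ∈ S ∧ x.1 m = some (a * c)} ⊆
      ⋃ c ∈ (T.Cprod n m).filter (· ∈ S), T.cyl m (f * c) := by
    rintro x ⟨hx, a, c, ha, hc, hx'⟩
    cases Option.some.inj (hx.symm.trans ha)
    obtain ⟨d, hd, h2⟩ := exists_mem_Cprod x h hx
    rw [hx'] at h2
    cases mul_left_cancel (Option.some.inj h2)
    exact Set.mem_biUnion (Finset.mem_filter.2 ⟨hd, hc⟩) hx'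
  refine (measure_mono h1).trans ((measure_biUnion_finset_le _ _).trans ?_)
  have h2 : {c | c ∈ T.Cprod n m ∧ c ∈ S} = ((T.Cprod n m).filter (· ∈ S) : Set G) := by
    ext; simp
  rw [h2, PMF.toOuterMeasure_apply_finset, Finset.sum_mul]
  refine Finset.sum_le_sum fun c hc => ?_
  have hc := (Finset.mem_filter.1 hc).1
  rw [measure_cyl hT m _ (hT.mul_mem h hf hc), hT.ν_mul_kprod h hf hc, mul_comm]

theorem measurableSet_step (n m : ℕ) (S : Set G) :
    MeasurableSet {x : T.Space | ∃ a c, x.1 n = some a ∧ c ∈ S ∧ x.1 m = some (a * c)} :=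
  measurableSet_setOfPred.2 <| .exists fun a => .exists fun c => Measurable.and
    (measurableSet_setOfPred.1 (measurableSet_cyl n a)) (measurable_const.and
      (measurableSet_setOfPred.1 (measurableSet_cyl m (a * c))))

/-- If a telescoping is compatible with `y`, then almost surely all but finitely many increments
`c_n` stabilize the corresponding coordinate of `y`. -/
theorem ae_eventually_mem_stabilizer (hT : T.IsParam) {q : ℕ → ℕ} (hq : StrictMono q)
    (y : Odometer Γ) (hc : (T.telescope q).Compatible y) :
    ∀ᵐ x ∂T.measure, ∀ᶠ n in atTop, ∀ a c, x.1 (q n) = some a → x.1 (q (n + 1)) = some (a * c) →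
      c • y.1 n = y.1 n := by
  have := ae_eventually_notMem_of_cyl hT hq
    (A := fun n => {x | ∃ a c, x.1 (q n) = some a ∧ c ∈ {c | c ∉ MulAction.stabilizer G (y.1 n)} ∧
      x.1 (q (n + 1)) = some (a * c)}) (fun n => measurableSet_step _ _ _) hc.ne
    (fun n f hf => measure_cyl_inter_step hT (hq.monotone n.le_succ) hf _)
  filter_upwards [this] with x hx
  filter_upwards [hx] with n hn a c ha hac
  by_contra hne
  exact hn ⟨a, c, ha, hne, hac⟩

theorem exists_coord_eq_some (x : T.Space) : ∀ᶠ n in atTop, ∃ f, x.1 n = some f := by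
  obtain ⟨n, f, hf⟩ := x.2.2.2.1
  filter_upwards [eventually_ge_atTop n] with m hm
  obtain ⟨c, -, h⟩ := exists_mem_Cprod x hm hf
  exact ⟨_, h⟩

/-- For large `m ≥ l` the increment `c` fixes `y_m`, hence `y_l`, so `f c y_l = f y_l` and the value
no longer changes. -/
theorem ae_exists_limit (hT : T.IsParam) (hΓ : Antitone Γ) {q : ℕ → ℕ} (hq : StrictMono q)
    (y : Odometer Γ) (hc : (T.telescope q).Compatible y) :
    ∀ᵐ x ∂T.measure, ∀ l, ∃ z : G ⧸ Γ l, ∀ᶠ m in atTop, ∃ f, x.1 (q m) = some f ∧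
      f • y.1 l = z := by
  filter_upwards [ae_eventually_mem_stabilizer hT hq y hc] with x hx l
  obtain ⟨N, hN⟩ := eventually_atTop.1
    (hx.and ((hq.tendsto_atTop.eventually (exists_coord_eq_some x)).and (eventually_ge_atTop l)))
  obtain ⟨-, ⟨f₀, hf₀⟩, -⟩ := hN N le_rfl
  refine ⟨f₀ • y.1 l, eventually_atTop.2 ⟨N, fun m hm => ?_⟩⟩
  induction m, hm using Nat.le_induction with
  | base => exact ⟨f₀, hf₀, rfl⟩
  | succ m hm ih =>
    obtain ⟨f, hf, hfy⟩ := ih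
    obtain ⟨c, -, hfc⟩ := exists_mem_Cprod x (hq.monotone m.le_succ) hf
    obtain ⟨h1, -, hlm⟩ := hN m hm
    refine ⟨f * c, hfc, ?_⟩
    rw [mul_smul, odometer_smul_coord hΓ y y hlm (h1 f c hf hfc), hfy]

/-- A compatible telescoping defines an equivariant mapping to the odometer. -/
theorem exists_equivariant_of_compatible (hT : T.IsParam) (hΓ : Antitone Γ) {q : ℕ → ℕ}
    (hq : StrictMono q) (y : Odometer Γ) (hc : (T.telescope q).Compatible y) :
    ∃ τ : T.Space → Odometer Γ, T.IsEquivariant τ ∧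
      ∀ᵐ x ∂T.measure, τ x ∈ (T.telescope q).factorMap y (telescopeMap hT hq x) := by
  classical
  have hcount : ∀ l, Countable (G ⧸ Γ l) := fun l => QuotientGroup.mk_surjective.countable
  let E (x : T.Space) (l : ℕ) (z : G ⧸ Γ l) : Prop :=
    ∀ᶠ m in atTop, ∃ f, x.1 (q m) = some f ∧ f • y.1 l = z
  have hEm : ∀ l z, MeasurableSet {x | E x l z} := fun l z => by
    simp only [E, eventually_atTop]
    exact measurableSet_setOfPred.2 <| .exists fun a => .forall fun m => measurable_const.imp
      (measurable_coord_mem (q m) {f | f • y.1 l = z})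
  have hEu : ∀ x l z z', E x l z → E x l z' → z = z' := by
    intro x l z z' h h'
    obtain ⟨m, ⟨f, hf, h1⟩, f', hf', h2⟩ := (h.and h').exists
    rw [hf] at hf'
    cases hf'
    exact h1.symm.trans h2
  have hexists : ∀ x, (∀ l, ∃ z, E x l z) → ∃ z : Odometer Γ, ∀ l, E x l (z.1 l) := by
    intro x hx
    choose z hz using hx
    refine ⟨⟨z, fun n => ?_⟩, hz⟩
    -- Both limits are attained at one common level, so neighbouring coordinates come from the same
    -- element `f` acting on `y`.
    obtain ⟨m, ⟨f, hf, h1⟩, f', hf', h2⟩ := ((hz n).and (hz (n + 1))).exists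
    rw [hf] at hf'
    cases hf'
    obtain ⟨g, hg, hg'⟩ := y.2 n
    exact ⟨f * g, by rw [← h2, hg]; rfl, by rw [← h1, hg']; rfl⟩
  -- The value `y` on the null set without limits is arbitrary.
  let τ : T.Space → Odometer Γ := fun x => if h : ∀ l, ∃ z, E x l z then (hexists x h).choose else y
  have hτ : ∀ x, (∀ l, ∃ z, E x l z) → ∀ l, E x l ((τ x).1 l) := by
    intro x h
    simp only [τ, dif_pos h]
    exact (hexists x h).choose_spec
  have hae := ae_exists_limit hT hΓ hq y hc
  refine ⟨τ, ⟨?_, fun g => ?_⟩, ?_⟩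
  · refine Measurable.subtype_mk (f := fun x => (τ x).1) (measurable_pi_lambda _ fun l => ?_)
    refine measurable_to_countable' fun z => ?_
    have hdom : MeasurableSet {x | ∀ l, ∃ z, E x l z} :=
      measurableSet_setOfPred.2 <| .forall fun l => .exists fun z =>
        measurableSet_setOfPred.1 (hEm l z)
    have : (fun x => (τ x).1 l) ⁻¹' {z} = ({x | ∀ l, ∃ z, E x l z} ∩ {x | E x l z}) ∪
        ({x | ∀ l, ∃ z, E x l z}ᶜ ∩ {_x | y.1 l = z}) := by
      ext x
      by_cases hx : ∀ l, ∃ z, E x l z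
      · have h1 : (τ x).1 l = z ↔ E x l z :=
          ⟨fun h => h ▸ hτ x hx l, fun h => hEu x l _ _ (hτ x hx l) h⟩
        simpa [hx] using h1
      · have : τ x = y := dif_neg hx
        simp [hx, this]
    rw [this]
    exact (hdom.inter (hEm l z)).union (hdom.compl.inter (MeasurableSet.const _))
  · filter_upwards [hae, ae_mem_actDomain hT g] with x hx hd
    obtain ⟨N, hN⟩ := isTranslate_act hT hd
    have h1 : ∀ l, E (T.act g x) l (g • (τ x).1 l) := by
      intro l
      filter_upwards [hτ x hx l, hq.tendsto_atTop.eventually (eventually_ge_atTop N)] with m h1 h2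
      obtain ⟨f, hf, h3⟩ := h1
      obtain ⟨f', hf', h4⟩ := hN _ h2
      rw [hf] at hf'
      cases hf'
      exact ⟨g * f, h4, by rw [mul_smul, h3]⟩
    exact Subtype.ext (funext fun l => hEu _ l _ _ (hτ _ (fun l => ⟨_, h1 l⟩) l) (h1 l))
  · filter_upwards [hae] with x hx
    exact (mem_factorMap_telescope hT hq y _ x).2 (hτ x hx)

end Limits
end CFData

/-! ### From equivariant mappings to compatible telescopings -/

namespace CFData

section Concentration

set_option linter.unusedSectionVars false

variable {G : Type*} [Group G] [DecidableEq G] [MeasurableSpace G] [Countable G]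
  [DiscreteMeasurableSpace G] {T : CFData G}

/-- A mapping of `X` to a finite set is approximated on each cylinder by mappings depending on one
coordinate. -/
theorem exists_coord_approx (hT : T.IsParam) {Z : Type*} [Finite Z] [Nonempty Z]
    [MeasurableSpace Z] [DiscreteMeasurableSpace Z] {φ : T.Space → Z} (hφ : Measurable φ)
    (k : ℕ) (f : G) {ε : ℝ≥0∞} (hε : ε ≠ 0) :
    ∃ N, ∀ n ≥ N, ∃ h : Option G → Z, T.measure (T.cyl k f ∩ {x | φ x ≠ h (x.1 n)}) < ε := by
  classical
  have := Fintype.ofFinite Z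
  have : IsFiniteMeasure (T.measure.restrict (T.cyl k f)) :=
    ⟨by simpa using (measure_cyl_ne_top hT k f).lt_top⟩
  have hε' : ε / Fintype.card Z ≠ 0 := by simp [hε]
  choose N hN using fun z : Z => exists_approx_of_coordinates (fun n (x : T.Space) => x.1 n)
    measurableSpace_eq_iSup (fun k n h x y hxy => coord_eq_of_coord_eq h hxy)
    (T.measure.restrict (T.cyl k f)) (hφ (MeasurableSet.of_discrete (s := {z}))) hε'
  refine ⟨Finset.univ.sup N, fun n hn => ?_⟩
  choose S hS using fun z => hN z n ((Finset.le_sup (Finset.mem_univ z)).trans hn)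
  -- Any `z` with `a ∈ S z` will do: outside the union of the symmetric differences, `φ x` is the
  -- only `z` with `x.1 n ∈ S z`.
  let h : Option G → Z := fun a => if ha : ∃ z, a ∈ S z then ha.choose else Classical.arbitrary Z
  refine ⟨h, ?_⟩
  have hsub : {x | φ x ≠ h (x.1 n)} ⊆
      ⋃ z ∈ Finset.univ, (φ ⁻¹' {z}) ∆ ((fun x : T.Space => x.1 n) ⁻¹' S z) := by
    intro x hx
    by_contra hne
    simp only [Finset.mem_univ, Set.iUnion_true, Set.mem_iUnion, Set.mem_symmDiff, not_exists,
      Set.mem_preimage, Set.mem_singleton_iff, not_or, not_and, not_not] at hne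
    have h1 : ∃ z, x.1 n ∈ S z := ⟨φ x, (hne (φ x)).1 rfl⟩
    have h2 : h (x.1 n) = h1.choose := dif_pos h1
    exact hx (h2 ▸ (hne _).2 h1.choose_spec)
  rw [Set.inter_comm, ← Measure.restrict_apply' (measurableSet_cyl k f)]
  refine (measure_mono hsub).trans_lt ((measure_biUnion_finset_le _ _).trans_lt ?_)
  refine (ENNReal.sum_lt_sum_of_nonempty Finset.univ_nonempty fun z _ => hS z).trans_le ?_
  simp only [Finset.sum_const, Finset.card_univ, nsmul_eq_mul]
  exact ENNReal.mul_div_le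

/-- An equivariant mapping to a finite `G`-set is almost constant on `[1]_n` for large `n`. -/
theorem exists_concentration (hT : T.IsParam) {Z : Type*} [MulAction G Z] [Finite Z] [Nonempty Z]
    [MeasurableSpace Z] [DiscreteMeasurableSpace Z] {φ : T.Space → Z} (hφ : Measurable φ)
    (heq : ∀ g : G, ∀ᵐ x ∂T.measure, φ (T.act g x) = g • φ x) {ε : ℝ≥0∞} (hε : ε ≠ 0) :
    ∃ N, ∀ n ≥ N, ∃ a : Z, ∀ f ∈ T.F n,
      T.measure (T.cyl n f ∩ {x | φ x ≠ f • a}) ≤ ε * T.ν n f := by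
  obtain ⟨N, hN⟩ := exists_coord_approx hT hφ 0 1 hε
  refine ⟨N, fun n hn => ?_⟩
  obtain ⟨h, hh⟩ := hN n hn
  have hmeas : MeasurableSet {x : T.Space | φ x ≠ h (x.1 n)} :=
    (measurableSet_eq_fun hφ (Measurable.of_discrete.comp (measurable_space_coord n))).compl
  have hmeas' : ∀ z, MeasurableSet {x : T.Space | φ x ≠ z} := fun z =>
    hφ (MeasurableSet.of_discrete (s := {z}ᶜ))
  have h1 : (1 : G) ∈ T.F 0 := hT.one_mem_F 0
  -- Averaging: if every cylinder had relative error above `ε`, summing over those inside `[1]_0`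
  -- would give a total of at least `ε ν_0(1) = ε`.
  obtain ⟨f₀, hf₀, h0⟩ : ∃ f ∈ T.F n,
      T.measure (T.cyl n f ∩ {x | φ x ≠ h (some f)}) ≤ ε * T.ν n f := by
    by_contra hne
    push Not at hne
    rw [measure_cyl_inter hT (Nat.zero_le n) h1 hmeas] at hh
    refine absurd hh (not_lt.2 ?_)
    calc ε = ε * T.ν 0 1 := by rw [hT.ν_zero]; simp
      _ = ∑ c ∈ T.Cprod 0 n, ε * T.ν n (1 * c) := by
          rw [← sum_ν_mul hT (Nat.zero_le n) h1, Finset.mul_sum]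
      _ ≤ _ := by
          refine Finset.sum_le_sum fun c hc => ?_
          refine (hne _ (hT.mul_mem (Nat.zero_le n) h1 hc)).le.trans (measure_mono ?_)
          rintro x ⟨hx, hx'⟩
          refine ⟨hx, ?_⟩
          rw [Set.mem_ofPred_eq, show x.1 n = some (1 * c) from hx]
          exact hx'
  -- The nearly constant value on `[f₀]_n` is pulled back to `[1]_n`; `T_{f f₀⁻¹}` then carries the
  -- estimate from `[f₀]_n` to `[f]_n`.
  refine ⟨f₀⁻¹ • h (some f₀), fun f hf => ?_⟩
  have hg : f * f₀⁻¹ * f₀ ∈ T.F n := by simpa using hf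
  have h2 := measure_cyl_inter_act_preimage hT hf₀ hg (hmeas' (f • f₀⁻¹ • h (some f₀)))
  rw [inv_mul_cancel_right] at h2
  have h3 : T.measure (T.cyl n f₀ ∩ T.act (f * f₀⁻¹) ⁻¹' {x | φ x ≠ f • f₀⁻¹ • h (some f₀)}) =
      T.measure (T.cyl n f₀ ∩ {x | φ x ≠ h (some f₀)}) := by
    refine measure_congr ?_
    filter_upwards [heq (f * f₀⁻¹)] with x hx
    refine propext (and_congr_right fun _ => ?_)
    change φ (T.act (f * f₀⁻¹) x) ≠ _ ↔ φ x ≠ _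
    rw [hx, ← mul_smul]
    exact (MulAction.injective (f * f₀⁻¹)).ne_iff
  rw [h3] at h2
  have hν : (T.ν n f₀ : ℝ≥0∞) ≠ 0 := by simpa using hT.ν_ne_zero hf₀
  rw [← ENNReal.mul_le_mul_iff_right hν ENNReal.coe_ne_top, h2]
  calc _ ≤ (T.ν n f : ℝ≥0∞) * (ε * T.ν n f₀) := by gcongr
    _ = _ := by ring

variable {Γ : ℕ → Subgroup G}

/-- If `τ` is almost constant on `[1]_{q_n}`, with values close to `y`, then the
`q`-telescoping is compatible with `y`. -/
theorem compatible_of_concentration (hT : T.IsParam) (hΓ : Antitone Γ) {τ : T.Space → Odometer Γ}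
    (hτ : Measurable τ) {q : ℕ → ℕ} (hq : StrictMono q) {y : Odometer Γ}
    (h : ∀ n, ∀ f ∈ T.F (q n),
      T.measure (T.cyl (q n) f ∩ {x | (τ x).1 n ≠ f • y.1 n}) ≤ 2⁻¹ ^ n * T.ν (q n) f) :
    (T.telescope q).Compatible y := by
  classical
  have hmeas : ∀ n z, MeasurableSet {x : T.Space | (τ x).1 n ≠ z} := fun n z =>
    ((measurable_pi_apply n).comp (measurable_subtype_coe.comp hτ))
      (MeasurableSet.of_discrete (s := {z}ᶜ))
  have key : ∀ n, (T.kprod (q n) (q (n + 1))).toOuterMeasure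
      {c | c ∈ T.Cprod (q n) (q (n + 1)) ∧ c ∉ MulAction.stabilizer G (y.1 n)} ≤
        2⁻¹ ^ n + 2⁻¹ ^ n := by
    intro n
    have hqn : q n ≤ q (n + 1) := hq.monotone n.le_succ
    have h1 : (1 : G) ∈ T.F (q n) := hT.one_mem_F _
    set S := (T.Cprod (q n) (q (n + 1))).filter (fun c => c ∉ MulAction.stabilizer G (y.1 n))
    have hS : {c | c ∈ T.Cprod (q n) (q (n + 1)) ∧ c ∉ MulAction.stabilizer G (y.1 n)} =
        (S : Set G) := by
      ext; simp [S]
    rw [hS, PMF.toOuterMeasure_apply_finset]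
    -- Multiplication by `ν(1)` turns the weight of `c` into the measure of `[c]` inside
    -- `[1]_{q_n}`.
    have hν : (T.ν (q n) 1 : ℝ≥0∞) ≠ 0 := by simpa using hT.ν_ne_zero h1
    rw [← ENNReal.mul_le_mul_iff_right hν ENNReal.coe_ne_top, Finset.mul_sum]
    have hSC : S ⊆ T.Cprod (q n) (q (n + 1)) := Finset.filter_subset _ _
    calc ∑ c ∈ S, (T.ν (q n) 1 : ℝ≥0∞) * T.kprod (q n) (q (n + 1)) c
        ≤ ∑ c ∈ S, (T.measure (T.cyl (q (n + 1)) (1 * c) ∩ {x | (τ x).1 n ≠ (1 : G) • y.1 n}) +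
            2⁻¹ ^ n * T.ν (q (n + 1)) (1 * c)) := by
          refine Finset.sum_le_sum fun c hc => ?_
          have hcC := hSC hc
          have hF := hT.mul_mem hqn h1 hcC
          rw [← hT.ν_mul_kprod hqn h1 hcC, ← measure_cyl hT _ _ hF]
          -- If `τ(x)_n = y_n` and `τ(x)_{n+1} = c y_{n+1}`, then projecting the second equality
          -- gives `c y_n = y_n`, which is excluded for `c ∈ S`.
          have h2 : T.cyl (q (n + 1)) (1 * c) ⊆
              (T.cyl (q (n + 1)) (1 * c) ∩ {x | (τ x).1 n ≠ (1 : G) • y.1 n}) ∪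
              (T.cyl (q (n + 1)) (1 * c) ∩ {x | (τ x).1 (n + 1) ≠ (1 * c) • y.1 (n + 1)}) := by
            intro x hx
            rw [← Set.inter_union_distrib_left]
            refine ⟨hx, ?_⟩
            by_contra hne
            simp only [Set.mem_union, Set.mem_ofPred_eq, not_or, not_not, one_mul, one_smul] at hne
            refine (Finset.mem_filter.1 hc).2 (MulAction.mem_stabilizer_iff.2 ?_)
            rw [odometer_smul_coord hΓ y (τ x) n.le_succ hne.2.symm, hne.1]
          refine (measure_mono h2).trans ((measure_union_le _ _).trans ?_)
          rw [measure_cyl hT _ _ hF]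
          gcongr
          refine (h (n + 1) _ hF).trans ?_
          gcongr ?_ * _
          exact pow_le_pow_right_of_le_one' (by simp) n.le_succ
      _ ≤ ∑ c ∈ T.Cprod (q n) (q (n + 1)),
            (T.measure (T.cyl (q (n + 1)) (1 * c) ∩ {x | (τ x).1 n ≠ (1 : G) • y.1 n}) +
            2⁻¹ ^ n * T.ν (q (n + 1)) (1 * c)) := Finset.sum_le_sum_of_subset hSC
      _ = T.measure (T.cyl (q n) 1 ∩ {x | (τ x).1 n ≠ (1 : G) • y.1 n}) +
            2⁻¹ ^ n * T.ν (q n) 1 := by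
          rw [Finset.sum_add_distrib, ← Finset.mul_sum, sum_ν_mul hT hqn h1,
            measure_cyl_inter hT hqn h1 (hmeas _ _)]
      _ ≤ 2⁻¹ ^ n * T.ν (q n) 1 + 2⁻¹ ^ n * T.ν (q n) 1 := by gcongr; exact h n 1 h1
      _ = _ := by ring
  refine (ENNReal.tsum_le_tsum key).trans_lt ?_
  rw [ENNReal.tsum_add, ENNReal.tsum_geometric]
  simp

/-- Existence of a point `y` of the odometer and a sequence `q` such that `τ` is almost constant on
the cylinders `[1]_{q_n}`. -/
theorem exists_concentrated_telescoping (hT : T.IsParam) (hΓ : Antitone Γ)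
    (hfin : ∀ n, (Γ n).FiniteIndex) {τ : T.Space → Odometer Γ} (hτ : T.IsEquivariant τ) :
    ∃ (q : ℕ → ℕ) (y : Odometer Γ), StrictMono q ∧ q 0 = 0 ∧ ∀ n, ∀ f ∈ T.F (q n),
      T.measure (T.cyl (q n) f ∩ {x | (τ x).1 n ≠ f • y.1 n}) ≤ 2⁻¹ ^ n * T.ν (q n) f := by
  have h1 : ∀ n : ℕ, ∃ m ≥ n, ∃ g : G, ∀ f ∈ T.F m,
      T.measure (T.cyl m f ∩ {x | (τ x).1 n ≠ f • (odometerOf Γ g).1 n}) ≤ 2⁻¹ ^ n * T.ν m f := by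
    intro n
    obtain ⟨N, hN⟩ := exists_concentration hT (φ := fun x => (τ x).1 n)
      ((measurable_pi_apply n).comp (measurable_subtype_coe.comp hτ.1))
      (fun g => by filter_upwards [hτ.2 g] with x hx; rw [hx]; rfl)
      (ε := 2⁻¹ ^ n) (by simp)
    obtain ⟨a, ha⟩ := hN (max N n) (le_max_left _ _)
    obtain ⟨g, rfl⟩ := QuotientGroup.mk_surjective a
    exact ⟨max N n, le_max_right _ _, g, ha⟩
  choose m hm g hg using h1
  -- Compactness of the odometer: as each `G/Γ_l` is finite, a nonprincipal ultrafilter selects the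
  -- limit coset at every `l` simultaneously.
  have h2 : ∀ l, ∃ z : G ⧸ Γ l, ∀ᶠ n in (hyperfilter ℕ : Filter ℕ), (g n : G ⧸ Γ l) = z := by
    intro l
    exact (Ultrafilter.eventually_exists_iff (f := hyperfilter ℕ)
      (P := fun z n => (g n : G ⧸ Γ l) = z)).1 (.of_forall fun n => ⟨_, rfl⟩)
  choose z hz using h2
  let y : Odometer Γ := ⟨z, fun l => by
    obtain ⟨n, h, h'⟩ := ((hz l).and (hz (l + 1))).exists
    exact ⟨g n, h'.symm, h.symm⟩⟩
  have h3 : ∀ k, ∃ᶠ j in atTop, ∀ f ∈ T.F j,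
      T.measure (T.cyl j f ∩ {x | (τ x).1 k ≠ f • y.1 k}) ≤ 2⁻¹ ^ k * T.ν j f := by
    intro k
    rw [frequently_atTop]
    intro K
    have hge : ∀ᶠ n in (hyperfilter ℕ : Filter ℕ), max k K ≤ n := by
      refine hyperfilter_le_cofinite ?_
      rw [Nat.cofinite_eq_atTop]
      exact eventually_ge_atTop _
    obtain ⟨n, hn, hn'⟩ := (hge.and (hz k)).exists
    -- Closeness in coordinate `n` implies closeness in coordinate `k ≤ n`, where `g n` already
    -- represents `y_k`; also `m n ≥ n ≥ K`.
    refine ⟨m n, ((le_max_right _ _).trans hn).trans (hm n), fun f hf => ?_⟩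
    have hkn : k ≤ n := (le_max_left _ _).trans hn
    calc _ ≤ T.measure (T.cyl (m n) f ∩ {x | (τ x).1 n ≠ f • (odometerOf Γ (g n)).1 n}) := by
          refine measure_mono fun x hx => ⟨hx.1, fun h => hx.2 ?_⟩
          rw [← odometer_smul_coord hΓ _ _ hkn h.symm]
          exact congrArg (f • ·) hn'
      _ ≤ 2⁻¹ ^ n * T.ν (m n) f := hg n f hf
      _ ≤ _ := by
          gcongr ?_ * _
          exact pow_le_pow_right_of_le_one' (by simp) hkn
  obtain ⟨p, hp, hp'⟩ := extraction_forall_of_frequently h3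
  -- Resetting the first term to `0` costs nothing: for `n = 0` the required bound is `2⁰ ν(f)`, the
  -- full measure of the cylinder.
  refine ⟨fun n => if n = 0 then 0 else p n, y, strictMono_nat_of_lt_succ fun n => ?_, rfl, ?_⟩
  · rcases eq_or_ne n 0 with rfl | hn
    · simpa using (Nat.zero_le _).trans_lt (hp Nat.zero_lt_one)
    · simpa [hn] using hp n.lt_succ_self
  · intro n f hf
    rcases eq_or_ne n 0 with rfl | hn
    · rw [pow_zero, one_mul, ← measure_cyl hT _ f hf]
      exact measure_mono Set.inter_subset_left
    · simp only [if_neg hn] at hf ⊢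
      exact hp' n f hf

/-- Every equivariant mapping to the odometer is given by a compatible telescoping. -/
theorem exists_compatible_of_equivariant (hT : T.IsParam) (hΓ : Antitone Γ)
    (hfin : ∀ n, (Γ n).FiniteIndex) {τ : T.Space → Odometer Γ} (hτ : T.IsEquivariant τ) :
    ∃ (q : ℕ → ℕ) (hq : StrictMono q) (y : Odometer Γ), q 0 = 0 ∧
      (T.telescope q).Compatible y ∧
      ∀ᵐ x ∂T.measure, τ x ∈ (T.telescope q).factorMap y (telescopeMap hT hq x) := by
  obtain ⟨q, y, hq, hq0, h⟩ := exists_concentrated_telescoping hT hΓ hfin hτ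
  refine ⟨q, hq, y, hq0, compatible_of_concentration hT hΓ hτ.1 hq h, ?_⟩
  have hmeas : ∀ n, MeasurableSet {x : T.Space | ∃ f, x.1 (q n) = some f ∧
      (τ x).1 n ≠ f • y.1 n} := fun n =>
    measurableSet_setOfPred.2 <| .exists fun f => Measurable.and
      (measurableSet_setOfPred.1 (measurableSet_cyl (q n) f))
      (measurableSet_setOfPred.1 (((measurable_pi_apply n).comp (measurable_subtype_coe.comp hτ.1))
      (MeasurableSet.of_discrete (s := {f • y.1 n}ᶜ))))
  have := ae_eventually_notMem_of_cyl hT hq hmeas (e := fun n => 2⁻¹ ^ n)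
    (by rw [ENNReal.tsum_geometric]; simp) (fun n f hf => by
      refine le_trans (measure_mono ?_) (h n f hf)
      rintro x ⟨hx, f', hf', hx'⟩
      cases Option.some.inj (hx.symm.trans hf')
      exact ⟨hx, hx'⟩)
  filter_upwards [this] with x hx
  rw [mem_factorMap_telescope]
  intro l
  filter_upwards [hx, hq.tendsto_atTop.eventually (exists_coord_eq_some x),
    eventually_ge_atTop l] with n hn ⟨f, hf⟩ hl
  refine ⟨f, hf, odometer_smul_coord hΓ y (τ x) hl ?_⟩
  by_contra hne
  exact hn ⟨f, hf, fun h => hne h.symm⟩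

end Concentration
end CFData

/-! ### Injectivity and approximation of cylinders -/

namespace CFData

section Injectivity

set_option linter.unusedSectionVars false

variable {G : Type*} [Group G] [DecidableEq G] [MeasurableSpace G] [Countable G]
  [DiscreteMeasurableSpace G] {T : CFData G} {Γ : ℕ → Subgroup G}

theorem measurable_odometer_coord {τ : T.Space → Odometer Γ} (hτ : Measurable τ) (l : ℕ) :
    Measurable fun x => (τ x).1 l :=
  (measurable_pi_apply l).comp (measurable_subtype_coe.comp hτ)

/-- The quantities of the approximation condition converge to the measures of the symmetric
differences of `[1]_{q_n}` and the sets `{x | τ(x)_l ∈ D}`. -/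
theorem tendsto_nu_symmDiff (hT : T.IsParam) {q : ℕ → ℕ} (hq : StrictMono q) {y : Odometer Γ}
    {τ : T.Space → Odometer Γ} (hτ : Measurable τ)
    (hlim : ∀ᵐ x ∂T.measure, ∀ l, ∀ᶠ m in atTop, ∃ f, x.1 (q m) = some f ∧
      f • y.1 l = (τ x).1 l) (hfin : T.measure Set.univ < ∞) (n l : ℕ) (D : Set (G ⧸ Γ l)) :
    Tendsto (fun m => ((T.telescope q).nu m (((T.telescope q).Cprod n m : Set G) ∆
      {f | f ∈ (T.telescope q).F m ∧ f • y.1 l ∈ D}) : ℝ≥0∞)) atTop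
      (𝓝 (T.measure (T.cyl (q n) 1 ∆ {x | (τ x).1 l ∈ D}))) := by
  have : IsFiniteMeasure T.measure := ⟨hfin⟩
  simp only [telescope_nu, ← measure_coord_mem hT]
  refine tendsto_measure_of_ae_tendsto_indicator_of_isFiniteMeasure atTop ?_ ?_ ?_
  · exact (measurableSet_cyl _ _).symmDiff
      (measurable_odometer_coord hτ l (MeasurableSet.of_discrete (s := D)))
  · exact fun m => measurableSet_setOfPred.2 (measurable_coord_mem _ _)
  -- Once `f_{q_m} y_l` has reached its limit `τ(x)_l` and `m ≥ n`, the indicators at `x` are equal,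
  -- not merely close.
  · filter_upwards [hlim] with x hx
    filter_upwards [hx l, eventually_ge_atTop n] with m ⟨f, hf, hfy⟩ hnm
    have hqnm := hq.monotone hnm
    have h1 : f ∈ T.Cprod (q n) (q m) ↔ x ∈ T.cyl (q n) 1 := by
      constructor
      · intro h
        exact hT.eq_of_Cprod x hqnm 1 (hT.one_mem_F _) f h (by simpa using hf)
      · intro h
        obtain ⟨c, hc, h'⟩ := exists_mem_Cprod x hqnm h
        rw [hf, one_mul] at h'
        cases h'
        exact hc
    have h2 : f ∈ T.F (q m) := x.2.1 _ _ hf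
    have h3 : f • y.1 l ∈ D ↔ x ∈ {x | (τ x).1 l ∈ D} := by rw [hfy]; rfl
    rw [telescope_Cprod hq hnm]
    constructor
    · rintro ⟨f', hf', h⟩
      cases Option.some.inj (hf.symm.trans hf')
      rw [Set.mem_symmDiff] at h ⊢
      rw [← h1, ← h3]
      simpa [telescope, h2] using h
    · intro h
      refine ⟨f, hf, ?_⟩
      rw [Set.mem_symmDiff] at h ⊢
      rw [← h1, ← h3] at h
      simpa [telescope, h2] using h

/-- The cylinder `[f]_n` is the preimage of `[1]_n` under the transformation inverse to `T_f`. -/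
theorem act_inv_mem_cyl_iff (hT : T.IsParam) {n : ℕ} {f : G} (hf : f ∈ T.F n) {x : T.Space}
    (hx : x ∈ T.actDomain f⁻¹) : T.act f⁻¹ x ∈ T.cyl n 1 ↔ x ∈ T.cyl n f := by
  constructor
  · intro h
    obtain ⟨N, hN⟩ := isTranslate_act hT hx
    obtain ⟨h', h1, h2⟩ := hN (max n N) (le_max_right _ _)
    obtain ⟨c, hc, h3⟩ := exists_mem_Cprod _ (le_max_left n N) h
    rw [h2, Option.some.injEq, inv_mul_eq_iff_eq_mul, one_mul] at h3
    subst h3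
    exact hT.eq_of_Cprod x (le_max_left n N) f hf c hc h1
  · intro h
    have := act_mem_cyl hT (g := f⁻¹) (by simpa using hT.one_mem_F n) h
    simpa using this

/-- If the cylinders `[1]_{q_n}` are preimages of sets under an equivariant mapping `τ` up to null
sets, then `τ` is one-to-one. -/
theorem injectiveModZero_of_cyl (hT : T.IsParam) {q : ℕ → ℕ} (hq : StrictMono q)
    {τ : T.Space → Odometer Γ} (hτ : T.IsEquivariant τ)
    (h : ∀ n > 0, ∃ A : Set (Odometer Γ), ∀ᵐ x ∂T.measure, x ∈ T.cyl (q n) 1 ↔ τ x ∈ A) :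
    T.InjectiveModZero τ := by
  choose! A hA using h
  have h1 : ∀ᵐ x ∂T.measure, ∀ n > 0, ∀ f ∈ T.F (q n),
      (x ∈ T.cyl (q n) f ↔ f⁻¹ • τ x ∈ A n) := by
    rw [ae_all_iff]; intro n
    by_cases hn : n > 0
    swap
    · exact .of_forall fun x h => absurd h hn
    refine Eventually.mono (p := fun x => ∀ f, f ∈ T.F (q n) →
      (x ∈ T.cyl (q n) f ↔ f⁻¹ • τ x ∈ A n)) ?_ fun x hx _ => hx
    rw [ae_all_iff]; intro f
    -- The statement about `[1]_{q_n}` is applied at `T_{f⁻¹} x`; nonsingularity keeps the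
    -- exceptional set null.
    filter_upwards [(quasiMeasurePreserving_act hT f⁻¹).ae (hA n hn), ae_mem_actDomain hT f⁻¹,
      hτ.2 f⁻¹] with x h1 h2 h3 hf
    rw [← act_inv_mem_cyl_iff hT hf h2, h1, h3]
  refine ⟨_, h1, ?_⟩
  intro x hx x' hx' hxx
  simp only [Set.mem_compl_iff, Set.mem_ofPred_eq, not_not] at hx hx'
  refine space_ext (n := 0) fun m _ => ?_
  -- The bound `n ≥ m + 1` ensures both `n > 0`, where the hypothesis applies, and `q n ≥ m`.
  obtain ⟨n, hn⟩ := ((hq.tendsto_atTop.eventually (exists_coord_eq_some x)).and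
    ((eventually_ge_atTop (m + 1)))).exists
  obtain ⟨⟨f, hf⟩, hnm⟩ := hn
  have hF : f ∈ T.F (q n) := x.2.1 _ _ hf
  have h2 := (hx n (by omega) f hF).1 hf
  rw [hxx] at h2
  have h3 : x'.1 (q n) = some f := (hx' n (by omega) f hF).2 h2
  exact coord_eq_of_coord_eq ((by omega : m ≤ n).trans hq.le_apply) (hf.trans h3.symm)

/-- A set which is approximated by preimages under `τ` of sets depending on one coordinate is a
preimage under `τ` up to a null set. -/
theorem exists_ae_mem_iff {τ : T.Space → Odometer Γ} {E : Set T.Space}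
    (h : ∀ ε : ℝ≥0, 0 < ε → ∃ (l : ℕ) (D : Set (G ⧸ Γ l)),
      T.measure (E ∆ {x | (τ x).1 l ∈ D}) ≤ ε) :
    ∃ A : Set (Odometer Γ), ∀ᵐ x ∂T.measure, x ∈ E ↔ τ x ∈ A := by
  choose l D hD using fun k : ℕ => h (2⁻¹ ^ k) (by positivity)
  -- With errors at most `2^{-k}`, Borel–Cantelli makes the lower limit of the approximating sets
  -- agree with `E` almost everywhere.
  refine ⟨{z | ∀ᶠ k in atTop, z.1 (l k) ∈ D k}, ?_⟩
  have hsum : ∑' k, T.measure (E ∆ {x | (τ x).1 (l k) ∈ D k}) ≠ ∞ := by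
    refine ne_top_of_le_ne_top ?_ (ENNReal.tsum_le_tsum hD)
    simp [ENNReal.tsum_geometric, ENNReal.inv_pow]
  filter_upwards [ae_eventually_notMem hsum] with x hx
  have h1 : ∀ᶠ k in atTop, (x ∈ E ↔ (τ x).1 (l k) ∈ D k) := by
    filter_upwards [hx] with k hk
    rw [Set.mem_symmDiff] at hk
    simp only [Set.mem_ofPred_eq] at hk
    tauto
  constructor
  · intro hE
    filter_upwards [h1] with k hk using hk.1 hE
  · intro hA
    have hA : ∀ᶠ k in atTop, (τ x).1 (l k) ∈ D k := hA
    obtain ⟨k, hk, hk'⟩ := (h1.and hA).exists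
    exact hk.2 hk'

/-- This makes the Lusin–Souslin theorem available: `X` is a measurable subset of a countable
product of countable discrete spaces. -/
theorem standardBorelSpace_space : StandardBorelSpace T.Space :=
  (measurableSet_spaceSet (T := T)).standardBorel

/-- If `τ` is one-to-one, then every measurable set is approximated by preimages under `τ` of sets
depending on one coordinate. -/
theorem exists_approx_of_injectiveModZero (hΓ : Antitone Γ) {τ : T.Space → Odometer Γ}
    (hτ : Measurable τ) (hfin : T.measure Set.univ < ∞) (hinj : T.InjectiveModZero τ)
    {E : Set T.Space} (hE : MeasurableSet E) {ε : ℝ≥0∞} (hε : ε ≠ 0) :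
    ∃ (l : ℕ) (D : Set (G ⧸ Γ l)), T.measure (E ∆ {x | (τ x).1 l ∈ D}) < ε := by
  have : IsFiniteMeasure T.measure := ⟨hfin⟩
  have : StandardBorelSpace T.Space := standardBorelSpace_space
  have hcount : ∀ l, Countable (G ⧸ Γ l) := fun l => QuotientGroup.mk_surjective.countable
  obtain ⟨N, hN, hNinj⟩ := hinj
  -- The exceptional set need not be measurable. Its measurable hull is still null, and outside it
  -- the injective image of `E` is measurable by Lusin–Souslin.
  have hM : MeasurableSet (toMeasurable T.measure N) := measurableSet_toMeasurable _ _
  have hM0 : T.measure (toMeasurable T.measure N) = 0 := by rwa [measure_toMeasurable]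
  have hMinj : Set.InjOn τ (toMeasurable T.measure N)ᶜ :=
    hNinj.mono (Set.compl_subset_compl.2 (subset_toMeasurable _ _))
  have hB : MeasurableSet (τ '' (E \ toMeasurable T.measure N)) :=
    (hE.diff hM).image_of_measurable_injOn hτ (hMinj.mono fun x hx => hx.2)
  have hgen : (inferInstance : MeasurableSpace (Odometer Γ)) =
      ⨆ n, MeasurableSpace.comap (fun y : Odometer Γ => y.1 n) inferInstance := by
    change MeasurableSpace.comap Subtype.val (⨆ n, MeasurableSpace.comap _ _) = _
    rw [MeasurableSpace.comap_iSup]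
    simp only [MeasurableSpace.comap_comp]
    rfl
  obtain ⟨l, hl⟩ := exists_approx_of_coordinates (fun n (y : Odometer Γ) => y.1 n) hgen
    (fun k n h x y hxy => odometer_coord_eq hΓ x y h hxy) (T.measure.map τ) hB hε
  obtain ⟨D, hD⟩ := hl l le_rfl
  refine ⟨l, D, ?_⟩
  have hDm : MeasurableSet ((fun y : Odometer Γ => y.1 l) ⁻¹' D) :=
    ((measurable_pi_apply l).comp measurable_subtype_coe) MeasurableSet.of_discrete
  rw [Measure.map_apply hτ (hB.symmDiff hDm)] at hD
  refine lt_of_eq_of_lt (measure_congr ?_) hD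
  filter_upwards [measure_eq_zero_iff_ae_notMem.1 hM0] with x hx
  have h1 : x ∈ E ↔ τ x ∈ τ '' (E \ toMeasurable T.measure N) := by
    constructor
    · exact fun h => ⟨x, ⟨h, hx⟩, rfl⟩
    · rintro ⟨x', hx', hxx⟩
      rw [← hMinj hx'.2 hx hxx]
      exact hx'.1
  refine propext ?_
  change x ∈ E ∆ {x | (τ x).1 l ∈ D} ↔ τ x ∈ _ ∆ _
  rw [Set.mem_symmDiff, Set.mem_symmDiff, ← h1]
  rfl

/-- The criterion of injectivity of the mapping to the odometer given by a telescoping. -/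
theorem injectiveModZero_iff_approxCondition (hT : T.IsParam) (hΓ : Antitone Γ) {q : ℕ → ℕ}
    (hq : StrictMono q) {y : Odometer Γ} {τ : T.Space → Odometer Γ} (hτ : T.IsEquivariant τ)
    (hlim : ∀ᵐ x ∂T.measure, τ x ∈ (T.telescope q).factorMap y (telescopeMap hT hq x))
    (hfin : T.measure Set.univ < ∞) :
    T.InjectiveModZero τ ↔ (T.telescope q).ApproxCondition y := by
  simp only [mem_factorMap_telescope] at hlim
  have hconv := fun n l D => tendsto_nu_symmDiff hT hq hτ.1 hlim hfin n l D
  constructor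
  · intro hinj n _ ε hε
    obtain ⟨l, D, h⟩ := exists_approx_of_injectiveModZero hΓ hτ.1 hfin hinj
      (measurableSet_cyl (q n) 1) (ε := ε) (by simpa using hε.ne')
    obtain ⟨M, hM⟩ := eventually_atTop.1 ((hconv n l D).eventually_lt_const h)
    refine ⟨l, D, max M (n + 1), by omega, fun m hm => ?_⟩
    exact_mod_cast hM m (by omega)
  · intro happ
    refine injectiveModZero_of_cyl hT hq hτ fun n hn => exists_ae_mem_iff fun ε hε => ?_
    obtain ⟨l, D, M, -, hM⟩ := happ n hn ε hε
    -- Only a non-strict bound survives the limit, which is all that `exists_ae_mem_iff` requires.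
    refine ⟨l, D, le_of_tendsto (hconv n l D) ?_⟩
    filter_upwards [eventually_gt_atTop M] with m hm
    exact_mod_cast (hM m hm).le

end Injectivity
end CFData

end

theorem theorem4p4 {G : Type*} [Group G] [Countable G] [DecidableEq G]
    [MeasurableSpace G] [DiscreteMeasurableSpace G]
    (T : CFData G) (hT : T.IsParam)
    (Γ : ℕ → Subgroup G) (hΓ : StrictAnti Γ) (hfin : ∀ n, (Γ n).FiniteIndex)
    (hcore : (⨅ n, ⨅ g : G, (Γ n).map (MulAut.conj g).toMonoidHom) = ⊥) :
    (∀ τ : T.Space → Odometer Γ, T.IsEquivariant τ →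
      -- every equivariant mapping is given by a compatible telescoping
      (∃ (q : ℕ → ℕ) (hq : StrictMono q) (y : Odometer Γ), q 0 = 0 ∧
        (T.telescope q).Compatible y ∧
        ∀ᵐ x ∂T.measure, τ x ∈ (T.telescope q).factorMap y (CFData.telescopeMap hT hq x)) ∧
      -- for each such telescoping, the criterion of injectivity
      (∀ (q : ℕ → ℕ) (hq : StrictMono q) (y : Odometer Γ), q 0 = 0 →
        (T.telescope q).Compatible y →
        (∀ᵐ x ∂T.measure, τ x ∈ (T.telescope q).factorMap y (CFData.telescopeMap hT hq x)) →
        T.measure Set.univ < ⊤ →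
        (T.InjectiveModZero τ ↔ (T.telescope q).ApproxCondition y))) ∧
    -- conversely, each compatible telescoping determines an equivariant mapping
    (∀ (q : ℕ → ℕ) (hq : StrictMono q) (y : Odometer Γ), q 0 = 0 →
      (T.telescope q).Compatible y →
      ∃ τ : T.Space → Odometer Γ, T.IsEquivariant τ ∧
        ∀ᵐ x ∂T.measure, τ x ∈ (T.telescope q).factorMap y (CFData.telescopeMap hT hq x)) := by
  have hA := hΓ.antitone
  refine ⟨fun τ hτ => ⟨CFData.exists_compatible_of_equivariant hT hA hfin hτ, ?_⟩, ?_⟩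
  · intro q hq y _ _ hlim hμ
    exact CFData.injectiveModZero_iff_approxCondition hT hA hq hτ hlim hμ
  · intro q hq y _ hc
    exact CFData.exists_equivariant_of_compatible hT hA hq y hc
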